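/- A rendezvous number of a metric space $(M,d)$ is a real number $r$ such that for each positive integer $n$ and all $x_1,\ldots,x_n\in M$ there exists $x\in M$ with $\frac1n\sum_{k=1}^n d(x_k,x)=r$. A (real or complex) Banach space has the average distance property (ADP) if its unit sphere, with the metric induced by the norm, has a unique rendezvous number. Theorem. For every $p$ with $2<p<\infty$, neither $l_p$ nor $L_p[0,1]$, over the real or over the complex scalars, has the average distance property. -/

import Mathlib

open MeasureTheory
open scoped ENNReal

/-- A real number `r` is a rendezvous number of the metric space `M` if for every positive
integer `n` and all points `x₁, …, xₙ` of `M` there is a point `y` of `M` whose average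
distance to `x₁, …, xₙ` is exactly `r`. -/
def IsRendezvousNumber (M : Type*) [MetricSpace M] (r : ℝ) : Prop :=
  ∀ n : ℕ, 0 < n → ∀ x : Fin n → M,
    ∃ y : M, (1 / (n : ℝ)) * ∑ k, dist (x k) y = r

/-- The average distance property: the unit sphere of `X`, with the metric induced by the norm,
has a unique rendezvous number. -/
def AverageDistanceProperty (X : Type*) [NormedAddCommGroup X] : Prop :=
  ∃! r : ℝ, IsRendezvousNumber (Metric.sphere (0 : X) 1) r

/-! For `2 < p < ∞` the unit sphere has no rendezvous number at all: two finite configurations force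
incompatible bounds on `r`. Upper bound: take `n` disjointly supported unit vectors. A unit vector
`y` has little mass on most supports, so its `p`-th power distances average at most `2 + η` for
large `n`. Jensen's inequality then gives `r ^ p ≤ 2 + η` for every `η > 0`
(`exists_disjoint_configuration`). Lower bound: cut the space into `n` blocks, take `u > 0` with
`p`-th power mass `1 / n` on each, and use all `2 ^ n` functions obtained by choosing a sign of `u`
on each block. For a unit vector `y` the `p`-th power of the distance is `M + ∑ ε_j D_j`, where `M =
2 + ∫ gain` and `D_j` is the integral of the fluctuation over block `j`. Since `p > 2`, the gain is
positive wherever `y ≠ 0`, so `M > 2`. Taking the root `q = 1 / p` is concave and costs about `q (1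
- q) / 2 · M ^ (q - 2) · V`, where `V = ∑ D_j ^ 2`, against an excess of about `q M ^ (q - 1) (M -
2)`. The pointwise estimate `fluct ^ 2 ≤ gain · (K ‖y‖ ^ p + K' ‖u‖ ^ p)` with `K` close to `4`
(`exists_sq_parallelogramFluct_le`) and Cauchy–Schwarz on each block give `V ≤ (K + τ) (M - 2)`.
With `M` at least `2` the ratio of cost to excess is then about `1 - q` at most, so the mean
distance exceeds `2 ^ (1 / p)` (`exists_sign_configuration`), hence `r ^ p > 2`. -/

/-! ### One-variable inequalities for real powers. -/

/-- A function with nonnegative second derivative on an open interval is minimal at a critical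
point. -/
theorem le_of_hasDerivAt_of_second_nonneg {f f' f'' : ℝ → ℝ} {a b c x : ℝ}
    (hf : ∀ t ∈ Set.Ioo a b, HasDerivAt f (f' t) t)
    (hf' : ∀ t ∈ Set.Ioo a b, HasDerivAt f' (f'' t) t)
    (hf'' : ∀ t ∈ Set.Ioo a b, 0 ≤ f'' t) (hc : c ∈ Set.Ioo a b) (hfc : f' c = 0)
    (hx : x ∈ Set.Ioo a b) : f c ≤ f x := by
  have hmono : MonotoneOn f' (Set.Ioo a b) := by
    refine monotoneOn_of_deriv_nonneg (convex_Ioo a b)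
      (fun t ht => (hf' t ht).continuousAt.continuousWithinAt) ?_ ?_
    · rw [interior_Ioo]
      exact fun t ht => (hf' t ht).differentiableAt.differentiableWithinAt
    · rw [interior_Ioo]
      intro t ht
      rw [(hf' t ht).deriv]
      exact hf'' t ht
  rcases lt_trichotomy c x with h | h | h
  · have hsub : ∀ t ∈ Set.Icc c x, t ∈ Set.Ioo a b := fun t ht =>
      ⟨hc.1.trans_le ht.1, ht.2.trans_lt hx.2⟩
    obtain ⟨ξ, hξ, he⟩ := exists_hasDerivAt_eq_slope f f' h
      (fun t ht => (hf t (hsub t ht)).continuousAt.continuousWithinAt)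
      (fun t ht => hf t (hsub t (Set.Ioo_subset_Icc_self ht)))
    have h1 : 0 ≤ f' ξ := hfc ▸ hmono hc (hsub ξ (Set.Ioo_subset_Icc_self hξ)) hξ.1.le
    rw [he, le_div_iff₀ (by linarith)] at h1
    linarith
  · rw [h]
  · have hsub : ∀ t ∈ Set.Icc x c, t ∈ Set.Ioo a b := fun t ht =>
      ⟨hx.1.trans_le ht.1, ht.2.trans_lt hc.2⟩
    obtain ⟨ξ, hξ, he⟩ := exists_hasDerivAt_eq_slope f f' h
      (fun t ht => (hf t (hsub t ht)).continuousAt.continuousWithinAt)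
      (fun t ht => hf t (hsub t (Set.Ioo_subset_Icc_self ht)))
    have h1 : f' ξ ≤ 0 := hfc ▸ hmono (hsub ξ (Set.Ioo_subset_Icc_self hξ)) hc hξ.2.le
    rw [he, div_le_iff₀ (by linarith)] at h1
    linarith

theorem hasDerivAt_one_add_mul_rpow (e s t : ℝ) (h : 0 < 1 + e * t) :
    HasDerivAt (fun t : ℝ => (1 + e * t) ^ s) (e * s * (1 + e * t) ^ (s - 1)) t := by
  have h1 : HasDerivAt (fun t : ℝ => 1 + e * t) e t := by
    simpa using ((hasDerivAt_id t).const_mul e).const_add 1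
  exact h1.rpow_const (Or.inl h.ne')

/-- A fourth-order lower bound for `(1 + t) ^ q`, whose quadratic coefficient can be chosen
arbitrarily close to the optimal one. -/
theorem exists_quartic_le_one_add_rpow {q c : ℝ} (hq : 0 < q) (hq1 : q < 1)
    (hc : q * (1 - q) < 2 * c) :
    ∃ C : ℝ, 0 ≤ C ∧ ∀ t : ℝ, -1 ≤ t →
      1 + q * t - c * t ^ 2 - C * t ^ 4 ≤ (1 + t) ^ q := by
  have hc0 : 0 < c := by nlinarith [mul_pos hq (sub_pos.2 hq1)]
  -- This `τ` makes `(1 + t) ^ q + c * t ^ 2` convex on `(-τ, 1)`, so there it lies above its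
  -- tangent at `0`.
  obtain ⟨τ, hτ0, hτ1, hτ⟩ : ∃ τ : ℝ, 0 < τ ∧ τ < 1 ∧ q * (1 - q) * (1 - τ) ^ (q - 2) < 2 * c := by
    have hcont : ContinuousAt (fun τ : ℝ => q * (1 - q) * (1 - τ) ^ (q - 2)) 0 := by
      refine ContinuousAt.mul continuousAt_const (ContinuousAt.rpow_const (by fun_prop) ?_)
      left; norm_num
    have h1 : ∀ᶠ τ in nhds (0 : ℝ), q * (1 - q) * (1 - τ) ^ (q - 2) < 2 * c := by
      apply hcont.eventually_lt continuousAt_const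
      simpa using hc
    have h2 : ∀ᶠ τ in nhds (0 : ℝ), τ < 1 := eventually_lt_nhds one_pos
    obtain ⟨ε, hε, h3⟩ := Metric.eventually_nhds_iff.1 (h1.and h2)
    have h4 := @h3 (ε / 2) (by simp [abs_of_pos hε, hε])
    exact ⟨ε / 2, by positivity, h4.2, h4.1⟩
  -- Once `τ ≤ |t|`, the first summand times `t ^ 4` absorbs the constant `1` and the second absorbs
  -- `q * t`.
  refine ⟨1 / τ ^ 4 + 1 / τ ^ 3, by positivity, fun t ht => ?_⟩
  by_cases hbig : τ ≤ |t|
  · have h1 : 1 ≤ 1 / τ ^ 4 * t ^ 4 := by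
      rw [one_div, inv_mul_eq_div, le_div_iff₀ (by positivity), one_mul, ← Even.pow_abs (by decide) t]
      gcongr
    have h2 : |t| ≤ 1 / τ ^ 3 * t ^ 4 := by
      rw [one_div, inv_mul_eq_div, le_div_iff₀ (by positivity), ← Even.pow_abs (by decide) t,
        pow_succ' |t|]
      gcongr
    have h3 : q * t ≤ |t| := by
      calc q * t ≤ q * |t| := by gcongr; exact le_abs_self t
        _ ≤ 1 * |t| := by gcongr
        _ = |t| := one_mul _
    have h4 : 0 ≤ (1 + t) ^ q := Real.rpow_nonneg (by linarith) _
    nlinarith [mul_nonneg hc0.le (sq_nonneg t)]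
  · push Not at hbig
    obtain ⟨hb1, hb2⟩ := abs_lt.1 hbig
    have key := le_of_hasDerivAt_of_second_nonneg (a := -τ) (b := 1) (c := 0) (x := t)
      (f := fun t => (1 + 1 * t) ^ q - (1 + q * t - c * t ^ 2))
      (f' := fun t => 1 * q * (1 + 1 * t) ^ (q - 1) - (q - c * (2 * t)))
      (f'' := fun t => q * (1 * (q - 1) * (1 + 1 * t) ^ (q - 1 - 1)) - (- (c * 2)))
      (by
        intro x hx
        have h1 : 0 < 1 + 1 * x := by linarith [hx.1]
        refine (hasDerivAt_one_add_mul_rpow 1 q x h1).sub ?_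
        have h2 : HasDerivAt (fun t : ℝ => 1 + q * t) q x := by
          simpa using ((hasDerivAt_id x).const_mul q).const_add 1
        refine h2.sub ?_
        simpa using ((hasDerivAt_id x).pow 2).const_mul c)
      (by
        intro x hx
        have h1 : 0 < 1 + 1 * x := by linarith [hx.1]
        have h3 := (hasDerivAt_one_add_mul_rpow 1 (q - 1) x h1).const_mul q
        simp only [one_mul] at h3 ⊢
        refine h3.sub ?_
        have h2 := (((hasDerivAt_id x).const_mul 2).const_mul c).const_sub q
        simpa using h2)
      (by
        intro x hx
        have h5 : (1 + 1 * x) ^ (q - 1 - 1) ≤ (1 - τ) ^ (q - 2) := by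
          rw [show q - 1 - 1 = q - 2 by ring]
          exact Real.rpow_le_rpow_of_nonpos (by linarith) (by linarith [hx.1]) (by linarith)
        have h6 : q * (1 - q) * (1 + 1 * x) ^ (q - 1 - 1) ≤ q * (1 - q) * (1 - τ) ^ (q - 2) :=
          mul_le_mul_of_nonneg_left h5 (mul_pos hq (sub_pos.2 hq1)).le
        nlinarith)
      ⟨by linarith, one_pos⟩ (by simp) ⟨hb1, by linarith⟩
    have h7 : 0 ≤ (1 / τ ^ 4 + 1 / τ ^ 3) * t ^ 4 := by positivity
    simp at key
    simp
    simp at h7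
    linarith

/-- Whatever the sign of `s - 2`, one of `(1 + t) ^ (s - 2)` and `(1 - t) ^ (s - 2)` is at least
`1`, which bounds the second derivative below. Keeping only one of them gives half the Taylor
coefficient, which is still enough for the constant `4` below. -/
theorem quadratic_le_symm_rpow {s t : ℝ} (hs : 1 < s) (ht : |t| < 1) :
    1 + s * (s - 1) / 4 * t ^ 2 ≤ ((1 + t) ^ s + (1 - t) ^ s) / 2 := by
  obtain ⟨h1, h2⟩ := abs_lt.1 ht
  have key := le_of_hasDerivAt_of_second_nonneg (a := -1) (b := 1) (c := 0) (x := t)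
      (f := fun t => ((1 + 1 * t) ^ s + (1 + (-1) * t) ^ s) - s * (s - 1) / 2 * t ^ 2)
      (f' := fun t => (1 * s * (1 + 1 * t) ^ (s - 1) + (-1) * s * (1 + (-1) * t) ^ (s - 1))
        - s * (s - 1) / 2 * (2 * t))
      (f'' := fun t => (1 * s * (1 * (s - 1) * (1 + 1 * t) ^ (s - 1 - 1)) +
        (-1) * s * ((-1) * (s - 1) * (1 + (-1) * t) ^ (s - 1 - 1))) - s * (s - 1) / 2 * 2)
      (by
        intro x hx
        refine ((hasDerivAt_one_add_mul_rpow 1 s x (by linarith [hx.1])).add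
          (hasDerivAt_one_add_mul_rpow (-1) s x (by linarith [hx.2]))).sub ?_
        simpa using ((hasDerivAt_id x).pow 2).const_mul (s * (s - 1) / 2))
      (by
        intro x hx
        refine (((hasDerivAt_one_add_mul_rpow 1 (s - 1) x (by linarith [hx.1])).const_mul _).add
          ((hasDerivAt_one_add_mul_rpow (-1) (s - 1) x (by linarith [hx.2])).const_mul _)).sub ?_
        simpa using ((hasDerivAt_id x).const_mul 2).const_mul (s * (s - 1) / 2))
      (by
        intro x hx
        have p1 : 0 ≤ (1 + 1 * x) ^ (s - 1 - 1) := Real.rpow_nonneg (by linarith [hx.1]) _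
        have p2 : 0 ≤ (1 + (-1) * x) ^ (s - 1 - 1) := Real.rpow_nonneg (by linarith [hx.2]) _
        have h3 : 1 ≤ (1 + 1 * x) ^ (s - 1 - 1) + (1 + (-1) * x) ^ (s - 1 - 1) := by
          rcases le_total 0 (s - 1 - 1) with hs2 | hs2 <;> rcases le_total 0 x with hx0 | hx0
          · linarith [Real.one_le_rpow (show 1 ≤ 1 + 1 * x by linarith) hs2]
          · linarith [Real.one_le_rpow (show 1 ≤ 1 + (-1) * x by linarith) hs2]
          · linarith [Real.one_le_rpow_of_pos_of_le_one_of_nonpos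
              (show 0 < 1 + (-1) * x by linarith [hx.2]) (by linarith) hs2]
          · linarith [Real.one_le_rpow_of_pos_of_le_one_of_nonpos
              (show 0 < 1 + 1 * x by linarith [hx.1]) (by linarith) hs2]
        have h4 : 0 ≤ s * (s - 1) := mul_nonneg (by linarith) (by linarith)
        nlinarith [mul_le_mul_of_nonneg_left h3 h4])
      ⟨by norm_num, one_pos⟩ (by simp) ⟨h1, h2⟩
  have e : ((1 + 1 * t) ^ s + (1 + (-1) * t) ^ s) = (1 + t) ^ s + (1 - t) ^ s := by
    congr 2 <;> ring
  have e0 : ((1 + 1 * (0 : ℝ)) ^ s + (1 + (-1) * (0 : ℝ)) ^ s) - s * (s - 1) / 2 * 0 ^ 2 = 2 := by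
    norm_num
  simp only [e, e0] at key
  linarith

/-- Bernoulli's inequality for the ratio `(A - B) / (A + B)`, when `B ≥ 0`; the other sign follows
by symmetry. -/
theorem abs_rpow_add_sub_rpow_sub_le {s A B : ℝ} (hs : 1 ≤ s) (hB : |B| ≤ A) :
    |((A + B) ^ s - (A - B) ^ s) / 2| ≤ s * |B| * (A + |B|) ^ (s - 1) := by
  have main : ∀ B : ℝ, 0 ≤ B → B ≤ A →
      |((A + B) ^ s - (A - B) ^ s) / 2| ≤ s * B * (A + B) ^ (s - 1) := by
    intro B h0 h1
    rcases eq_or_lt_of_le h0 with rfl | hpos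
    · simp
    have hAB : 0 < A + B := by linarith
    have hle : (A - B) ^ s ≤ (A + B) ^ s := Real.rpow_le_rpow (by linarith) (by linarith) (by linarith)
    rw [abs_of_nonneg (by linarith)]
    have h2 : 1 + s * (-(2 * B / (A + B))) ≤ (1 + -(2 * B / (A + B))) ^ s := by
      refine one_add_mul_self_le_rpow_one_add ?_ hs
      rw [neg_le_neg_iff, div_le_one hAB]
      linarith
    have h3 : 1 + -(2 * B / (A + B)) = (A - B) / (A + B) := by field_simp; ring
    rw [h3, Real.div_rpow (by linarith) hAB.le, le_div_iff₀ (by positivity)] at h2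
    have h4 : (A + B) ^ s = (A + B) * (A + B) ^ (s - 1) := by
      rw [← Real.rpow_one_add' hAB.le (by linarith)]; congr 1; ring
    have h5 : (1 + s * (-(2 * B / (A + B)))) * (A + B) ^ s
        = (A + B) ^ s - 2 * s * B * (A + B) ^ (s - 1) := by
      rw [h4]; field_simp; ring
    rw [h5] at h2
    linarith
  rcases le_total 0 B with h | h
  · rw [abs_of_nonneg h] at hB ⊢
    exact main B h hB
  · rw [abs_of_nonpos h] at hB ⊢
    have := main (-B) (by linarith) hB
    rw [← abs_neg]
    convert this using 2
    rw [sub_neg_eq_add, ← sub_eq_add_neg]; ring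

theorem rpow_le_symm_rpow {s A B : ℝ} (hs : 1 ≤ s) (hB : |B| ≤ A) :
    A ^ s ≤ ((A + B) ^ s + (A - B) ^ s) / 2 := by
  obtain ⟨h1, h2⟩ := abs_le.1 hB
  have := (convexOn_rpow hs).2 (show A + B ∈ Set.Ici (0 : ℝ) by simp; linarith)
    (show A - B ∈ Set.Ici (0 : ℝ) by simp; linarith) (show (0 : ℝ) ≤ 1 / 2 by norm_num)
    (show (0 : ℝ) ≤ 1 / 2 by norm_num) (by norm_num)
  simp only [smul_eq_mul] at this
  rw [show 1 / 2 * (A + B) + 1 / 2 * (A - B) = A by ring] at this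
  linarith

/-- Bernoulli's inequality at `x` if `x ≤ 1`, and at `x⁻¹` after factoring out `x ^ s` if `x ≥ 1`.
-/
theorem min_le_one_add_rpow {s x : ℝ} (hs : 1 < s) (hx : 0 ≤ x) :
    (s - 1) * min 1 x ≤ (1 + x) ^ s - 1 - x ^ s := by
  rcases eq_or_lt_of_le hx with rfl | hpos
  · simp [Real.zero_rpow (by linarith : s ≠ 0)]
  rcases le_total x 1 with h | h
  · rw [min_eq_right h]
    have h1 := one_add_mul_self_le_rpow_one_add (by linarith : -1 ≤ x) hs.le
    have h2 : x ^ s ≤ x := by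
      simpa using Real.rpow_le_rpow_of_exponent_ge hpos h hs.le
    linarith
  · rw [min_eq_left h]
    have h1 := one_add_mul_self_le_rpow_one_add (by linarith [inv_pos.2 hpos] : -1 ≤ x⁻¹) hs.le
    have h2 : (1 + x⁻¹) = (1 + x) / x := by field_simp; ring
    have hxs : 0 < x ^ s := by positivity
    rw [h2, Real.div_rpow (by linarith) hx, le_div_iff₀ hxs] at h1
    have h3 : x ^ s = x * x ^ (s - 1) := by
      rw [← Real.rpow_one_add' hx (by linarith)]; congr 1; ring
    have h4 : 1 ≤ x ^ (s - 1) := Real.one_le_rpow h (by linarith)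
    have h5 : (1 + s * x⁻¹) * x ^ s = x ^ s + s * x ^ (s - 1) := by
      rw [h3]; field_simp
    nlinarith

theorem symm_rpow_gain_lower_bound {s z T : ℝ} (hs : 1 < s) (hT : |T| ≤ 2 * z) :
    (s - 1) * min 1 (z ^ 2)
      ≤ ((1 + z ^ 2 + T) ^ s + (1 + z ^ 2 - T) ^ s) / 2 - 1 - (z ^ 2) ^ s := by
  have h1 := min_le_one_add_rpow hs (sq_nonneg z)
  have h2 := rpow_le_symm_rpow (A := 1 + z ^ 2) hs.le (hT.trans (by nlinarith [sq_nonneg (z - 1)]))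
  linarith

theorem abs_symm_rpow_fluct_le {s z T : ℝ} (hs : 1 < s) (hz : 0 ≤ z) (hT : |T| ≤ 2 * z) :
    (((1 + z ^ 2 + T) ^ s - (1 + z ^ 2 - T) ^ s) / 2) ^ 2
      ≤ T ^ 2 * (s ^ 2 * ((1 + z) ^ (2 * (s - 1))) ^ 2) := by
  have h1 := abs_rpow_add_sub_rpow_sub_le (A := 1 + z ^ 2) hs.le
    (hT.trans (by nlinarith [sq_nonneg (z - 1)]))
  have h2 : (1 + z ^ 2 + |T|) ^ (s - 1) ≤ (1 + z) ^ (2 * (s - 1)) := by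
    rw [Real.rpow_mul (by linarith)]
    refine Real.rpow_le_rpow (by positivity) ?_ (by linarith)
    rw [Real.rpow_two]
    linarith
  rw [← sq_abs (((1 + z ^ 2 + T) ^ s - (1 + z ^ 2 - T) ^ s) / 2), ← sq_abs T]
  calc _ ≤ (s * |T| * (1 + z) ^ (2 * (s - 1))) ^ 2 := by
        gcongr
        exact h1.trans (by gcongr)
    _ = _ := by ring

/-- To leading order as `z → 0`, the squared fluctuation is at most `s ^ 2 * T ^ 2`, while the gain
is at least `T ^ 2 / 4 * (s * (s - 1) + s) = s ^ 2 * T ^ 2 / 4`. The quotient is `4`, and continuity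
covers any `K > 4`. -/
theorem exists_sq_fluct_le_mul_gain_near_zero {s K : ℝ} (hs : 1 < s) (hK : 4 < K) :
    ∃ δ : ℝ, 0 < δ ∧ δ ≤ 1 ∧ ∀ z T : ℝ, 0 ≤ z → z ≤ δ → |T| ≤ 2 * z →
      (((1 + z ^ 2 + T) ^ s - (1 + z ^ 2 - T) ^ s) / 2) ^ 2
        ≤ K * (((1 + z ^ 2 + T) ^ s + (1 + z ^ 2 - T) ^ s) / 2 - 1 - (z ^ 2) ^ s) := by
  have hev : ∀ᶠ z in nhds (0 : ℝ), 4 * (s ^ 2 * ((1 + z) ^ (2 * (s - 1))) ^ 2)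
      < K * (s * (s - 1) * (1 + z ^ 2) ^ (s - 2) + s - (z ^ 2) ^ (s - 1)) := by
    refine ContinuousAt.eventually_lt (f := fun z : ℝ => 4 * (s ^ 2 * ((1 + z) ^ (2 * (s - 1))) ^ 2))
      (g := fun z : ℝ => K * (s * (s - 1) * (1 + z ^ 2) ^ (s - 2) + s - (z ^ 2) ^ (s - 1))) ?_ ?_ ?_
    · refine continuousAt_const.mul (continuousAt_const.mul (ContinuousAt.pow ?_ 2))
      exact ContinuousAt.rpow_const (by fun_prop) (Or.inl (by norm_num))
    · refine continuousAt_const.mul (ContinuousAt.sub (ContinuousAt.add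
        (continuousAt_const.mul ?_) continuousAt_const) ?_)
      · exact ContinuousAt.rpow_const (by fun_prop) (Or.inl (by norm_num))
      · exact ContinuousAt.rpow_const (by fun_prop) (Or.inr (by linarith))
    · have : s - 1 ≠ 0 := by linarith
      simp [Real.zero_rpow this]
      nlinarith [sq_pos_of_pos (by linarith : 0 < s)]
  obtain ⟨ε, hε, h⟩ := Metric.eventually_nhds_iff.1 hev
  refine ⟨min (ε / 2) (1 / 4), by positivity, (min_le_right _ _).trans (by norm_num), ?_⟩
  intro z T hz hzδ hT
  have hz1 : z ≤ 1 / 4 := hzδ.trans (min_le_right _ _)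
  have hmain := @h z (by
    rw [Real.dist_0_eq_abs, abs_of_nonneg hz]
    exact (hzδ.trans (min_le_left _ _)).trans_lt (by linarith))
  refine (abs_symm_rpow_fluct_le hs hz hT).trans ?_
  have hA : 0 < 1 + z ^ 2 := by positivity
  have hTA : |T / (1 + z ^ 2)| < 1 := by
    rw [abs_div, abs_of_pos hA, div_lt_one hA]
    nlinarith [sq_nonneg z]
  have h1 := quadratic_le_symm_rpow hs hTA
  have e1 : 1 + T / (1 + z ^ 2) = (1 + z ^ 2 + T) / (1 + z ^ 2) := by field_simp
  have e2 : 1 - T / (1 + z ^ 2) = (1 + z ^ 2 - T) / (1 + z ^ 2) := by field_simp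
  obtain ⟨hT1, hT2⟩ := abs_le.1 hT
  rw [e1, e2, Real.div_rpow (by nlinarith) hA.le, Real.div_rpow (by nlinarith) hA.le, ← add_div,
    div_div, mul_comm _ (2 : ℝ), ← div_div, le_div_iff₀ (by positivity)] at h1
  have e3 : (1 + z ^ 2) ^ s = (1 + z ^ 2) ^ (s - 2) * (1 + z ^ 2) ^ 2 := by
    rw [← Real.rpow_two (1 + z ^ 2), ← Real.rpow_add hA]; congr 1; ring
  have e4 : (1 + s * (s - 1) / 4 * (T / (1 + z ^ 2)) ^ 2) * (1 + z ^ 2) ^ s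
      = (1 + z ^ 2) ^ s + s * (s - 1) / 4 * T ^ 2 * (1 + z ^ 2) ^ (s - 2) := by
    rw [e3]; field_simp
  rw [e4] at h1
  have h2 := one_add_mul_self_le_rpow_one_add (by nlinarith [sq_nonneg z] : -1 ≤ z ^ 2) hs.le
  have e5 : (z ^ 2) ^ s = z ^ 2 * (z ^ 2) ^ (s - 1) := by
    rw [← Real.rpow_one_add' (sq_nonneg z) (by linarith)]; congr 1; ring
  have h3 : (z ^ 2) ^ (s - 1) ≤ 1 :=
    Real.rpow_le_one (sq_nonneg z) (by nlinarith) (by linarith)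
  have h4 : T ^ 2 ≤ 4 * z ^ 2 := by nlinarith [sq_abs T, abs_nonneg T]
  -- Trading `z ^ 2` for `T ^ 2 / 4` makes the whole lower bound for the gain proportional to `T ^
  -- 2`, as is the bound for the fluctuation.
  have h5 : T ^ 2 / 4 * (s - (z ^ 2) ^ (s - 1)) ≤ z ^ 2 * (s - (z ^ 2) ^ (s - 1)) :=
    mul_le_mul_of_nonneg_right (by linarith) (by linarith)
  have h6 : T ^ 2 / 4 * (s * (s - 1) * (1 + z ^ 2) ^ (s - 2) + s - (z ^ 2) ^ (s - 1))
      ≤ ((1 + z ^ 2 + T) ^ s + (1 + z ^ 2 - T) ^ s) / 2 - 1 - (z ^ 2) ^ s := by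
    rw [e5]; linarith
  calc T ^ 2 * (s ^ 2 * ((1 + z) ^ (2 * (s - 1))) ^ 2)
      = T ^ 2 / 4 * (4 * (s ^ 2 * ((1 + z) ^ (2 * (s - 1))) ^ 2)) := by ring
    _ ≤ T ^ 2 / 4 * (K * (s * (s - 1) * (1 + z ^ 2) ^ (s - 2) + s - (z ^ 2) ^ (s - 1))) := by
        gcongr
    _ = K * (T ^ 2 / 4 * (s * (s - 1) * (1 + z ^ 2) ^ (s - 2) + s - (z ^ 2) ^ (s - 1))) := by ring
    _ ≤ _ := by gcongr

/-- Away from the regime of small `z` the size of the constant is irrelevant: it will multiply the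
mass of `u` on a block, which is `1 / n`. -/
theorem exists_sq_fluct_le_mul_gain_of_le {s R : ℝ} (hs : 1 < s) (hR : 1 ≤ R) :
    ∃ K : ℝ, 0 ≤ K ∧ ∀ z T : ℝ, 0 ≤ z → z ≤ R → |T| ≤ 2 * z →
      (((1 + z ^ 2 + T) ^ s - (1 + z ^ 2 - T) ^ s) / 2) ^ 2
        ≤ K * (((1 + z ^ 2 + T) ^ s + (1 + z ^ 2 - T) ^ s) / 2 - 1 - (z ^ 2) ^ s) := by
  have hs1 : 0 < s - 1 := by linarith
  refine ⟨4 * R ^ 2 * (s ^ 2 * ((1 + R) ^ (2 * (s - 1))) ^ 2) / (s - 1), by positivity, ?_⟩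
  intro z T hz hzR hT
  have h1 := abs_symm_rpow_fluct_le hs hz hT
  have h2 := symm_rpow_gain_lower_bound hs hT
  have h4 : T ^ 2 ≤ 4 * z ^ 2 := by nlinarith [sq_abs T, abs_nonneg T]
  have h5 : z ^ 2 ≤ R ^ 2 * min 1 (z ^ 2) := by
    rcases le_total 1 (z ^ 2) with h | h
    · rw [min_eq_left h]; nlinarith
    · rw [min_eq_right h]; exact le_mul_of_one_le_left (sq_nonneg z) (one_le_pow₀ hR)
  calc _ ≤ _ := h1
    _ ≤ (4 * (R ^ 2 * min 1 (z ^ 2))) * (s ^ 2 * ((1 + R) ^ (2 * (s - 1))) ^ 2) := by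
        gcongr
        linarith
    _ = 4 * R ^ 2 * (s ^ 2 * ((1 + R) ^ (2 * (s - 1))) ^ 2) / (s - 1)
        * ((s - 1) * min 1 (z ^ 2)) := by field_simp
    _ ≤ _ := by gcongr

/-! ### Pointwise comparison of gain and fluctuation. -/

/-- The excess of the mean of `‖a + b‖ ^ p` and `‖a - b‖ ^ p` over `‖a‖ ^ p + ‖b‖ ^ p`. -/
noncomputable def parallelogramGain {E : Type*} [NormedAddCommGroup E] (p : ℝ) (a b : E) : ℝ :=
  (‖a - b‖ ^ p + ‖a + b‖ ^ p) / 2 - ‖a‖ ^ p - ‖b‖ ^ p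

/-- Half the difference of `‖a - b‖ ^ p` and `‖a + b‖ ^ p`. -/
noncomputable def parallelogramFluct {E : Type*} [NormedAddCommGroup E] (p : ℝ) (a b : E) : ℝ :=
  (‖a - b‖ ^ p - ‖a + b‖ ^ p) / 2

section Pointwise

variable {E : Type*} [NormedAddCommGroup E]

theorem parallelogramGain_comm (p : ℝ) (a b : E) :
    parallelogramGain p a b = parallelogramGain p b a := by
  unfold parallelogramGain
  rw [norm_sub_rev a b, add_comm a b]
  ring

theorem parallelogramFluct_comm (p : ℝ) (a b : E) :
    parallelogramFluct p a b = parallelogramFluct p b a := by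
  unfold parallelogramFluct
  rw [norm_sub_rev a b, add_comm a b]

/-- Either `‖b‖` is at most a small multiple `δ * ‖a‖`, and the factor `(1 + δ) ^ p` is close to
`1`, or `‖a‖ ≤ ‖b‖ / δ` and the `b` term alone suffices. -/
theorem exists_norm_sub_rpow_le {p η : ℝ} (hp : 0 < p) (hη : 0 < η) :
    ∃ C : ℝ, 0 ≤ C ∧ ∀ a b : E, ‖a - b‖ ^ p ≤ (1 + η) * ‖a‖ ^ p + C * ‖b‖ ^ p := by
  obtain ⟨δ, hδ, hδη⟩ : ∃ δ : ℝ, 0 < δ ∧ (1 + δ) ^ p < 1 + η := by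
    have hcont : ContinuousAt (fun x : ℝ => (1 + x) ^ p) 0 :=
      ContinuousAt.rpow_const (by fun_prop) (Or.inl (by norm_num))
    have h1 : ∀ᶠ x in nhds (0 : ℝ), (1 + x) ^ p < 1 + η :=
      hcont.eventually_lt continuousAt_const (by simpa using hη)
    obtain ⟨ε, hε, h⟩ := Metric.eventually_nhds_iff.1 h1
    exact ⟨ε / 2, by positivity, @h (ε / 2) (by simp [abs_of_pos hε, hε])⟩
  refine ⟨(1 / δ + 1) ^ p, by positivity, fun a b => ?_⟩
  rcases le_total ‖b‖ (δ * ‖a‖) with h | h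
  · calc ‖a - b‖ ^ p ≤ ((1 + δ) * ‖a‖) ^ p := by
          gcongr
          linarith [norm_sub_le a b]
      _ = (1 + δ) ^ p * ‖a‖ ^ p := Real.mul_rpow (by positivity) (norm_nonneg _)
      _ ≤ (1 + η) * ‖a‖ ^ p + 0 := by rw [add_zero]; gcongr
      _ ≤ _ := by gcongr; positivity
  · calc ‖a - b‖ ^ p ≤ ((1 / δ + 1) * ‖b‖) ^ p := by
          gcongr
          have : ‖a‖ ≤ 1 / δ * ‖b‖ := by
            rw [one_div, inv_mul_eq_div, le_div_iff₀ hδ]; linarith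
          linarith [norm_sub_le a b]
      _ = 0 + (1 / δ + 1) ^ p * ‖b‖ ^ p := by
          rw [Real.mul_rpow (by positivity) (norm_nonneg _), zero_add]
      _ ≤ _ := by gcongr; positivity

/-- Both `‖b - a‖ ^ p` and `‖b + a‖ ^ p` differ from `‖b‖ ^ p` by at most `η * ‖b‖ ^ p + C * ‖a‖ ^
p`; the lower estimates come from the upper one applied to `b = (b - a) - (-a)`. -/
theorem exists_abs_parallelogramFluct_le {p η : ℝ} (hp : 0 < p) (hη : 0 < η) :
    ∃ C : ℝ, 0 ≤ C ∧ ∀ a b : E, |parallelogramFluct p a b| ≤ η * ‖b‖ ^ p + C * ‖a‖ ^ p := by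
  obtain ⟨C, hC, h⟩ := exists_norm_sub_rpow_le (E := E) hp hη
  have h1 : ∀ a b : E, ‖b - a‖ ^ p ≤ (1 + η) * ‖b‖ ^ p + C * ‖a‖ ^ p := fun a b => h b a
  have h2 : ∀ a b : E, ‖b‖ ^ p ≤ (1 + η) * ‖b - a‖ ^ p + C * ‖a‖ ^ p := fun a b => by
    simpa using h (b - a) (-a)
  have h3 : ∀ a b : E, (1 - η) * ‖b‖ ^ p - C * ‖a‖ ^ p ≤ ‖b - a‖ ^ p := fun a b => by
    have hb : 0 ≤ ‖b‖ ^ p := by positivity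
    have ha : 0 ≤ C * ‖a‖ ^ p := by positivity
    by_contra hcon
    push Not at hcon
    have h4 := h2 a b
    nlinarith [mul_nonneg hη.le ha, mul_nonneg (mul_nonneg hη.le hη.le) hb,
      mul_lt_mul_of_pos_left hcon (show 0 < 1 + η by linarith)]
  refine ⟨C, hC, fun a b => ?_⟩
  unfold parallelogramFluct
  rw [abs_le]
  have e1 : a + b = b - -a := by abel
  have k1 := h1 a b
  have k2 := h1 (-a) b
  have k3 := h3 a b
  have k4 := h3 (-a) b
  rw [← e1] at k2 k4
  rw [norm_neg] at k2 k4
  rw [norm_sub_rev b a] at k1 k3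
  constructor <;> linarith

variable {𝕜 : Type*} [RCLike 𝕜]

/-- The parallelogram law in `𝕜` says that, after division by `‖a‖ ^ 2`, the squares of `‖a - b‖`
and `‖a + b‖` are `1 + z ^ 2 ± T` with `z = ‖b‖ / ‖a‖`. This reduces everything to one-variable
inequalities with exponent `p / 2 > 1`. -/
theorem exists_parallelogram_normal_form {p : ℝ} {a b : 𝕜} (ha : a ≠ 0) :
    ∃ T : ℝ, |T| ≤ 2 * (‖b‖ / ‖a‖) ∧
      parallelogramGain p a b = ‖a‖ ^ p *
        (((1 + (‖b‖ / ‖a‖) ^ 2 + T) ^ (p / 2) + (1 + (‖b‖ / ‖a‖) ^ 2 - T) ^ (p / 2)) / 2 - 1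
          - ((‖b‖ / ‖a‖) ^ 2) ^ (p / 2)) ∧
      parallelogramFluct p a b ^ 2 = (‖a‖ ^ p *
        (((1 + (‖b‖ / ‖a‖) ^ 2 + T) ^ (p / 2) - (1 + (‖b‖ / ‖a‖) ^ 2 - T) ^ (p / 2)) / 2)) ^ 2 := by
  have hna : 0 < ‖a‖ := norm_pos_iff.2 ha
  set x := ‖a‖ with hx
  set y := ‖b‖ with hy
  have hpar := parallelogram_law_with_norm_mul 𝕜 a b
  have h1 : ‖a + b‖ ≤ x + y := norm_add_le a b
  have h2 : ‖a - b‖ ≤ x + y := norm_sub_le a b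
  have hy0 : 0 ≤ y := norm_nonneg _
  have n1 := norm_nonneg (a + b)
  have n2 := norm_nonneg (a - b)
  have sq_rpow : ∀ w : ℝ, 0 ≤ w → (w ^ 2) ^ (p / 2) = w ^ p := fun w hw => by
    rw [← Real.rpow_natCast_mul hw]; congr 1; push_cast; ring
  refine ⟨(‖a - b‖ ^ 2 - ‖a + b‖ ^ 2) / (2 * x ^ 2), ?_, ?_⟩
  · have h3 : ‖a + b‖ ^ 2 ≤ (x + y) ^ 2 := by gcongr
    have h4 : ‖a - b‖ ^ 2 ≤ (x + y) ^ 2 := by gcongr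
    rw [abs_div, abs_of_pos (by positivity : 0 < 2 * x ^ 2), div_le_iff₀ (by positivity)]
    have e : 2 * (y / x) * (2 * x ^ 2) = 4 * x * y := by field_simp; ring
    rw [e, abs_le]
    constructor <;> nlinarith
  · have e1 : 1 + (y / x) ^ 2 + (‖a - b‖ ^ 2 - ‖a + b‖ ^ 2) / (2 * x ^ 2) = (‖a - b‖ / x) ^ 2 := by
      field_simp; nlinarith
    have e2 : 1 + (y / x) ^ 2 - (‖a - b‖ ^ 2 - ‖a + b‖ ^ 2) / (2 * x ^ 2) = (‖a + b‖ / x) ^ 2 := by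
      field_simp; nlinarith
    rw [e1, e2, sq_rpow _ (by positivity), sq_rpow _ (by positivity), sq_rpow _ (by positivity),
      Real.div_rpow n2 hna.le, Real.div_rpow n1 hna.le, Real.div_rpow hy0 hna.le]
    have hxp : 0 < x ^ p := by positivity
    unfold parallelogramGain parallelogramFluct
    rw [← hx, ← hy]
    constructor <;> field_simp

theorem parallelogramGain_nonneg {p : ℝ} (hp : 2 < p) (a b : 𝕜) : 0 ≤ parallelogramGain p a b := by
  by_cases ha : a = 0
  · simp [parallelogramGain, ha, Real.zero_rpow (by linarith : p ≠ 0)]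
  obtain ⟨T, hT, h1, -⟩ := exists_parallelogram_normal_form (p := p) (b := b) ha
  rw [h1]
  have := symm_rpow_gain_lower_bound (by linarith : 1 < p / 2) hT
  refine mul_nonneg (by positivity) (le_trans ?_ this)
  have : 0 ≤ p / 2 - 1 := by linarith
  positivity

theorem parallelogramGain_pos {p : ℝ} (hp : 2 < p) {a b : 𝕜} (ha : a ≠ 0) (hb : b ≠ 0) :
    0 < parallelogramGain p a b := by
  obtain ⟨T, hT, h1, -⟩ := exists_parallelogram_normal_form (p := p) (b := b) ha
  rw [h1]
  have := symm_rpow_gain_lower_bound (by linarith : 1 < p / 2) hT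
  have hna : 0 < ‖a‖ := norm_pos_iff.2 ha
  have hnb : 0 < ‖b‖ := norm_pos_iff.2 hb
  refine mul_pos (by positivity) (lt_of_lt_of_le ?_ this)
  have : 0 < p / 2 - 1 := by linarith
  positivity

/-- The square of the fluctuation is controlled by the gain, with a constant in front of `‖b‖ ^ p`
that can be any number above `4`. -/
theorem exists_sq_parallelogramFluct_le {p K : ℝ} (hp : 2 < p) (hK : 4 < K) :
    ∃ K' : ℝ, 0 ≤ K' ∧ ∀ a b : 𝕜, parallelogramFluct p a b ^ 2
      ≤ parallelogramGain p a b * (K * ‖b‖ ^ p + K' * ‖a‖ ^ p) := by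
  have hs : 1 < p / 2 := by linarith
  obtain ⟨δ, hδ, hδ1, h1⟩ := exists_sq_fluct_le_mul_gain_near_zero hs hK
  obtain ⟨K', hK', h2⟩ := exists_sq_fluct_le_mul_gain_of_le hs (one_le_one_div hδ hδ1)
  refine ⟨K', hK', fun a b => ?_⟩
  have hg := parallelogramGain_nonneg hp a b
  by_cases ha : a = 0
  · subst ha
    have : parallelogramFluct p 0 b = 0 := by simp [parallelogramFluct]
    rw [this]
    have : 0 ≤ K * ‖b‖ ^ p + K' * ‖(0 : 𝕜)‖ ^ p := by positivity
    nlinarith [mul_nonneg hg this]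
  have hna : 0 < ‖a‖ := norm_pos_iff.2 ha
  -- If `a` is small against `b`, normalise by `b`, so that the sharp constant falls on `‖b‖ ^ p`.
  -- Otherwise normalise by `a`, where the ratio `‖b‖ / ‖a‖` is at most `1 / δ`.
  rcases le_total ‖a‖ (δ * ‖b‖) with h | h
  · have hnb : 0 < ‖b‖ := by
      by_contra hcon
      nlinarith
    have hb : b ≠ 0 := norm_pos_iff.1 hnb
    obtain ⟨T, hT, e1, e2⟩ := exists_parallelogram_normal_form (p := p) (b := a) hb
    have h3 := h1 (‖a‖ / ‖b‖) T (by positivity) ((div_le_iff₀ hnb).2 h) hT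
    rw [parallelogramFluct_comm, e2, mul_pow]
    calc _ ≤ _ := mul_le_mul_of_nonneg_left h3 (by positivity)
      _ = parallelogramGain p a b * (K * ‖b‖ ^ p + 0) := by
        rw [parallelogramGain_comm, e1]; ring
      _ ≤ _ := by gcongr; positivity
  · obtain ⟨T, hT, e1, e2⟩ := exists_parallelogram_normal_form (p := p) (b := b) ha
    have h3 := h2 (‖b‖ / ‖a‖) T (by positivity)
      (by rw [div_le_div_iff₀ hna hδ]; linarith) hT
    rw [e2, mul_pow]
    calc _ ≤ _ := mul_le_mul_of_nonneg_left h3 (by positivity)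
      _ = parallelogramGain p a b * (0 + K' * ‖a‖ ^ p) := by
        rw [e1]; ring
      _ ≤ _ := by gcongr; positivity

end Pointwise

/-! ### Cauchy–Schwarz and moments of Rademacher sums. -/

/-- Cauchy–Schwarz in the form used for a pointwise bound `d ^ 2 ≤ g * h`. -/
theorem sq_integral_le_of_sq_le_mul {Ω : Type*} [MeasurableSpace Ω] {μ : Measure Ω}
    {d g h : Ω → ℝ} (hd : Integrable d μ) (hg : Integrable g μ) (hh : Integrable h μ)
    (hg0 : ∀ ω, 0 ≤ g ω) (hh0 : ∀ ω, 0 ≤ h ω) (hle : ∀ ω, d ω ^ 2 ≤ g ω * h ω) :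
    (∫ ω, d ω ∂μ) ^ 2 ≤ (∫ ω, g ω ∂μ) * ∫ ω, h ω ∂μ := by
  -- The integrand `g x ^ 2 + 2 d x + h` is nonnegative, since `g` times it is at least `(g x + d) ^
  -- 2`; the discriminant of the integrated quadratic gives the claim.
  have key : ∀ x : ℝ, 0 ≤ (∫ ω, g ω ∂μ) * (x * x) + (2 * ∫ ω, d ω ∂μ) * x + ∫ ω, h ω ∂μ := by
    intro x
    have e : ∫ ω, (g ω * (x * x) + d ω * (2 * x) + h ω) ∂μ
        = (∫ ω, g ω ∂μ) * (x * x) + (2 * ∫ ω, d ω ∂μ) * x + ∫ ω, h ω ∂μ := by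
      have hg' := hg.mul_const (x * x)
      have hd' := hd.mul_const (2 * x)
      rw [integral_add (f := fun ω => g ω * (x * x) + d ω * (2 * x)) (hg'.add hd') hh,
        integral_add hg' hd', integral_mul_const, integral_mul_const]
      ring
    rw [← e]
    refine integral_nonneg fun ω => ?_
    have h1 := hle ω
    have h2 := hg0 ω
    have h3 := hh0 ω
    change 0 ≤ g ω * (x * x) + d ω * (2 * x) + h ω
    rcases eq_or_lt_of_le h2 with h4 | h4
    · rw [← h4] at h1 ⊢
      have : d ω = 0 := by nlinarith
      rw [this]; linarith
    · have : 0 ≤ g ω * (g ω * (x * x) + d ω * (2 * x) + h ω) := by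
        nlinarith [sq_nonneg (g ω * x + d ω)]
      exact nonneg_of_mul_nonneg_right this h4
  have := discrim_le_zero key
  unfold discrim at this
  nlinarith

/-- The value `1` or `-1` attached to a Boolean. -/
def boolSign (b : Bool) : ℝ := if b then 1 else -1

theorem sum_bool_fin_succ {n : ℕ} (F : (Fin (n + 1) → Bool) → ℝ) :
    ∑ ε, F ε = ∑ ε : Fin n → Bool, (F (Fin.cons true ε) + F (Fin.cons false ε)) := by
  rw [← (Fin.consEquiv (fun _ : Fin (n + 1) => Bool)).sum_comp, Fintype.sum_prod_type]
  simp [Fin.consEquiv, Finset.sum_add_distrib]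

theorem sum_boolSign_cons {n : ℕ} (d : Fin (n + 1) → ℝ) (b : Bool) (ε : Fin n → Bool) :
    ∑ j, boolSign ((Fin.cons b ε : Fin (n + 1) → Bool) j) * d j
      = boolSign b * d 0 + ∑ j, boolSign (ε j) * d j.succ := by
  rw [Fin.sum_univ_succ]; simp

theorem sum_sign_sum_eq_zero {n : ℕ} (d : Fin n → ℝ) :
    ∑ ε : Fin n → Bool, ∑ j, boolSign (ε j) * d j = 0 := by
  induction n with
  | zero => simp
  | succ n ih =>
    rw [sum_bool_fin_succ]
    simp only [sum_boolSign_cons]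
    have := ih (fun j => d j.succ)
    calc _ = ∑ ε : Fin n → Bool, 2 * ∑ j, boolSign (ε j) * d j.succ :=
          Finset.sum_congr rfl fun ε _ => by simp [boolSign]; ring
      _ = 0 := by rw [← Finset.mul_sum, this, mul_zero]

theorem sum_sign_sum_sq {n : ℕ} (d : Fin n → ℝ) :
    ∑ ε : Fin n → Bool, (∑ j, boolSign (ε j) * d j) ^ 2 = 2 ^ n * ∑ j, d j ^ 2 := by
  induction n with
  | zero => simp
  | succ n ih =>
    rw [sum_bool_fin_succ]
    simp only [sum_boolSign_cons]
    have := ih (fun j => d j.succ)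
    calc _ = ∑ ε : Fin n → Bool, (2 * d 0 ^ 2 + 2 * (∑ j, boolSign (ε j) * d j.succ) ^ 2) :=
          Finset.sum_congr rfl fun ε _ => by simp [boolSign]; ring
      _ = _ := by
          simp only [Finset.sum_add_distrib, ← Finset.mul_sum, this, Fin.sum_univ_succ]
          simp; ring

/-- Induction peels off one sign; odd powers cancel. What matters is that the constant `3` does not
depend on `n`. -/
theorem sum_sign_sum_pow_four_le {n : ℕ} (d : Fin n → ℝ) :
    ∑ ε : Fin n → Bool, (∑ j, boolSign (ε j) * d j) ^ 4 ≤ 2 ^ n * (3 * (∑ j, d j ^ 2) ^ 2) := by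
  induction n with
  | zero => simp
  | succ n ih =>
    rw [sum_bool_fin_succ]
    simp only [sum_boolSign_cons]
    have h4 := ih (fun j => d j.succ)
    have h2 := sum_sign_sum_sq (fun j => d j.succ)
    calc _ = ∑ ε : Fin n → Bool, (2 * d 0 ^ 4 + 12 * d 0 ^ 2 *
            (∑ j, boolSign (ε j) * d j.succ) ^ 2 + 2 * (∑ j, boolSign (ε j) * d j.succ) ^ 4) :=
          Finset.sum_congr rfl fun ε _ => by simp [boolSign]; ring
      _ = 2 ^ n * (2 * d 0 ^ 4) + 12 * d 0 ^ 2 * (2 ^ n * ∑ j : Fin n, d j.succ ^ 2)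
            + 2 * ∑ ε : Fin n → Bool, (∑ j, boolSign (ε j) * d j.succ) ^ 4 := by
          simp only [Finset.sum_add_distrib, ← Finset.mul_sum, h2]
          simp; ring
      _ ≤ _ := by
          rw [Fin.sum_univ_succ, pow_succ (2 : ℝ)]
          have h0 : (0 : ℝ) ≤ 2 ^ n * d 0 ^ 4 := by positivity
          linear_combination 2 * h4 + 4 * h0

/-- If the variance of a Rademacher sum is small compared with the excess of the mean `M` over `2`,
then the mean of the `q`-th powers exceeds `2 ^ q`. -/
theorem two_rpow_lt_mean_sign_rpow {q c C M W : ℝ} (hq : 0 < q) (hq1 : q < 1) (hc : 0 ≤ c)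
    (hC : 0 ≤ C)
    (hquart : ∀ t : ℝ, -1 ≤ t → 1 + q * t - c * t ^ 2 - C * t ^ 4 ≤ (1 + t) ^ q)
    (hM : 2 < M) {n : ℕ} (d : Fin n → ℝ)
    (hnonneg : ∀ ε : Fin n → Bool, 0 ≤ M + ∑ j, boolSign (ε j) * d j)
    (hW : ∑ j, d j ^ 2 ≤ W)
    (hV : (c / 2 + 3 * C / 8 * W) * ∑ j, d j ^ 2 < q * (M - 2)) :
    2 ^ n * 2 ^ q < ∑ ε : Fin n → Bool, (M + ∑ j, boolSign (ε j) * d j) ^ q := by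
  have hM0 : 0 < M := by linarith
  set V := ∑ j, d j ^ 2 with hVdef
  have hV0 : 0 ≤ V := Finset.sum_nonneg fun j _ => sq_nonneg _
  have hMq : 0 < M ^ q := by positivity
  have step : ∀ ε : Fin n → Bool,
      M ^ q * (1 + q / M * (∑ j, boolSign (ε j) * d j)
        - c / M ^ 2 * (∑ j, boolSign (ε j) * d j) ^ 2
        - C / M ^ 4 * (∑ j, boolSign (ε j) * d j) ^ 4)
      ≤ (M + ∑ j, boolSign (ε j) * d j) ^ q := by
    intro ε
    have h0 := hnonneg ε
    set S := ∑ j, boolSign (ε j) * d j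
    have h1 := hquart (S / M) (by rw [le_div_iff₀ hM0]; linarith)
    have e : M + S = M * (1 + S / M) := by field_simp
    have h2 : 0 ≤ 1 + S / M := by
      have : 1 + S / M = (M + S) / M := by field_simp
      rw [this]; positivity
    rw [e, Real.mul_rpow hM0.le h2]
    refine mul_le_mul_of_nonneg_left (le_trans (le_of_eq ?_) h1) hMq.le
    rw [div_pow, div_pow]; ring
  have hsum := Finset.sum_le_sum fun ε (_ : ε ∈ (Finset.univ : Finset (Fin n → Bool))) => step ε
  rw [← Finset.mul_sum, Finset.sum_sub_distrib, Finset.sum_sub_distrib, Finset.sum_add_distrib,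
    ← Finset.mul_sum, ← Finset.mul_sum, ← Finset.mul_sum, sum_sign_sum_eq_zero,
    sum_sign_sum_sq] at hsum
  have h4 := sum_sign_sum_pow_four_le d
  rw [← hVdef] at hsum h4
  have h5 : C / M ^ 4 * ∑ ε : Fin n → Bool, (∑ j, boolSign (ε j) * d j) ^ 4
      ≤ C / M ^ 4 * (2 ^ n * (3 * V ^ 2)) := by gcongr
  have hcard : ∑ _ε : Fin n → Bool, (1 : ℝ) = 2 ^ n := by simp
  have hlow : 2 ^ n * (M ^ q * (1 - c / M ^ 2 * V - C / M ^ 4 * (3 * V ^ 2)))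
      ≤ ∑ ε : Fin n → Bool, (M + ∑ j, boolSign (ε j) * d j) ^ q := by
    refine le_trans ?_ hsum
    rw [hcard]
    calc _ = M ^ q * (2 ^ n + q / M * 0 - c / M ^ 2 * (2 ^ n * V)
          - C / M ^ 4 * (2 ^ n * (3 * V ^ 2))) := by ring
      _ ≤ _ := by gcongr
  refine lt_of_lt_of_le ?_ hlow
  -- Concavity, as Bernoulli's inequality for `2 = M * (1 - (M - 2) / M)`.
  have h2q : (2 : ℝ) ^ q ≤ M ^ q * (1 - q * (M - 2) / M) := by
    have e : (2 : ℝ) = M * (1 + (-((M - 2) / M))) := by field_simp; ring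
    have h6 : (1 + (-((M - 2) / M))) ^ q ≤ 1 + q * (-((M - 2) / M)) :=
      rpow_one_add_le_one_add_mul_self
        (by rw [neg_le_neg_iff, div_le_one hM0]; linarith) hq.le hq1.le
    calc (2 : ℝ) ^ q = (M * (1 + (-((M - 2) / M)))) ^ q := by rw [← e]
      _ = M ^ q * (1 + (-((M - 2) / M))) ^ q := Real.mul_rpow hM0.le (by
          have : 1 + (-((M - 2) / M)) = 2 / M := by field_simp; ring
          rw [this]; positivity)
      _ ≤ M ^ q * (1 + q * (-((M - 2) / M))) := by gcongr
      _ = _ := by ring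
  -- After multiplication by `M`, the bound `M > 2` turns `c / M` and `3 * C / M ^ 3` into the `c /
  -- 2` and `3 * C / 8` of the hypothesis.
  have hfin : c / M ^ 2 * V + C / M ^ 4 * (3 * V ^ 2) < q * (M - 2) / M := by
    rw [lt_div_iff₀ hM0]
    refine lt_of_le_of_lt ?_ hV
    have a1 : c / M ^ 2 * V * M ≤ c / 2 * V := by
      have : c / M ^ 2 * V * M = c / M * V := by field_simp
      rw [this]
      gcongr
    have a2 : C / M ^ 4 * (3 * V ^ 2) * M ≤ 3 * C / 8 * W * V := by
      have : C / M ^ 4 * (3 * V ^ 2) * M = 3 * C / M ^ 3 * V * V := by field_simp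
      rw [this]
      gcongr
      have : (2 : ℝ) ^ 3 ≤ M ^ 3 := by gcongr
      linarith
    linarith
  have : M ^ q * (1 - q * (M - 2) / M)
      < M ^ q * (1 - c / M ^ 2 * V - C / M ^ 4 * (3 * V ^ 2)) :=
    mul_lt_mul_of_pos_left (by linarith) hMq
  have hn : (0 : ℝ) < 2 ^ n := by positivity
  exact mul_lt_mul_of_pos_left (h2q.trans_lt this) hn

/-! ### Integration over a finite partition into blocks. -/

section Blocks

variable {Ω : Type*} [MeasurableSpace Ω] {μ : Measure Ω}

theorem sum_setIntegral_fiber {n : ℕ} {B : Ω → Fin n} (hB : Measurable B) {F : Ω → ℝ}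
    (hF : Integrable F μ) : ∑ j, ∫ ω in B ⁻¹' {j}, F ω ∂μ = ∫ ω, F ω ∂μ := by
  rw [← integral_iUnion_fintype (fun j => hB (measurableSet_singleton j)) ?_
    (fun j => hF.integrableOn)]
  · rw [show ⋃ j, B ⁻¹' {j} = Set.univ by ext; simp, setIntegral_univ]
  · exact fun i j hij => Set.disjoint_left.2 fun ω h1 h2 => hij (h1.symm.trans h2)

theorem integrable_comp_fiber_mul {n : ℕ} {B : Ω → Fin n} (hB : Measurable B) (φ : Fin n → ℝ)
    {F : Ω → ℝ} (hF : Integrable F μ) : Integrable (fun ω => φ (B ω) * F ω) μ := by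
  have h : IntegrableOn (fun ω => φ (B ω) * F ω) (⋃ j, B ⁻¹' {j}) μ := by
    rw [integrableOn_finite_iUnion]
    intro j
    refine (integrableOn_congr_fun (g := fun ω => φ j * F ω) ?_
      (hB (measurableSet_singleton j))).2 (hF.const_mul _).integrableOn
    intro ω hω
    simp only [Set.mem_preimage, Set.mem_singleton_iff] at hω
    simp [hω]
  rwa [show ⋃ j, B ⁻¹' {j} = Set.univ by ext; simp, integrableOn_univ] at h

theorem integral_comp_fiber_mul {n : ℕ} {B : Ω → Fin n} (hB : Measurable B) (φ : Fin n → ℝ)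
    {F : Ω → ℝ} (hF : Integrable F μ) :
    ∫ ω, φ (B ω) * F ω ∂μ = ∑ j, φ j * ∫ ω in B ⁻¹' {j}, F ω ∂μ := by
  rw [← sum_setIntegral_fiber hB (integrable_comp_fiber_mul hB φ hF)]
  refine Finset.sum_congr rfl fun j _ => ?_
  rw [← integral_const_mul]
  refine setIntegral_congr_fun (hB (measurableSet_singleton j)) fun ω hω => ?_
  simp only [Set.mem_preimage, Set.mem_singleton_iff] at hω
  simp [hω]

/-- A positive function with prescribed `p`-th moment `1 / n` on each of `n` non-null blocks. -/
theorem exists_pos_setIntegral_rpow_eq [SigmaFinite μ] {p : ℝ} (hp : 0 < p) {n : ℕ} (hn : 0 < n)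
    {B : Ω → Fin n} (hB : Measurable B) (hpos : ∀ j, μ (B ⁻¹' {j}) ≠ 0) :
    ∃ u : Ω → ℝ, Measurable u ∧ (∀ ω, 0 < u ω) ∧ Integrable (fun ω => u ω ^ p) μ ∧
      ∀ j, ∫ ω in B ⁻¹' {j}, u ω ^ p ∂μ = 1 / n := by
  -- By `σ`-finiteness there is a positive integrable `g`; `u` is the `p`-th root of `g` rescaled on
  -- each block.
  obtain ⟨g, g_pos, g_meas, g_int⟩ := exists_pos_lintegral_lt_of_sigmaFinite μ one_ne_zero
  have hg : Integrable (fun ω => (g ω : ℝ)) μ := by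
    refine ⟨by fun_prop, ?_⟩
    rw [hasFiniteIntegral_iff_enorm]
    simpa using g_int.trans ENNReal.one_lt_top
  have hc : ∀ j, 0 < ∫ ω in B ⁻¹' {j}, (g ω : ℝ) ∂μ := by
    intro j
    rw [setIntegral_pos_iff_support_of_nonneg_ae (.of_forall fun ω => by positivity)
      hg.integrableOn]
    have : Function.support (fun ω => (g ω : ℝ)) = Set.univ := by
      ext ω; simpa using (g_pos ω).ne'
    rw [this, Set.univ_inter]
    exact pos_iff_ne_zero.2 (hpos j)
  have hn' : (0 : ℝ) < n := by exact_mod_cast hn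
  set φ : Fin n → ℝ := fun j => (n * ∫ ω in B ⁻¹' {j}, (g ω : ℝ) ∂μ)⁻¹ with hφ
  have hφ_pos : ∀ j, 0 < φ j := fun j => inv_pos.2 (mul_pos hn' (hc j))
  have hu : ∀ ω, ((φ (B ω) * g ω) ^ (1 / p)) ^ p = φ (B ω) * g ω := fun ω => by
    rw [one_div, Real.rpow_inv_rpow (mul_nonneg (hφ_pos _).le (by positivity)) hp.ne']
  refine ⟨fun ω => (φ (B ω) * g ω) ^ (1 / p), ?_, fun ω => ?_, ?_, fun j => ?_⟩
  · exact (((measurable_of_finite φ).comp hB).mul (by fun_prop)).pow_const _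
  · exact Real.rpow_pos_of_pos (mul_pos (hφ_pos _) (by exact_mod_cast g_pos ω)) _
  · simp only [hu]
    exact integrable_comp_fiber_mul hB φ hg
  · simp only [hu]
    have : ∫ ω in B ⁻¹' {j}, φ (B ω) * g ω ∂μ = ∫ ω in B ⁻¹' {j}, φ j * g ω ∂μ := by
      refine setIntegral_congr_fun (hB (measurableSet_singleton j)) fun ω hω => ?_
      simp only [Set.mem_preimage, Set.mem_singleton_iff] at hω
      simp [hω]
    rw [this, integral_const_mul, hφ]
    have := (hc j).ne'
    field_simp

end Blocks

/-! ### The two finite configurations of unit vectors. -/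

section Configurations

variable {Ω : Type*} [MeasurableSpace Ω] {μ : Measure Ω} {𝕜 : Type*} [RCLike 𝕜] {p : ℝ≥0∞}

theorem integrable_parallelogramGain (h0 : p ≠ 0) (htop : p ≠ ∞) {a y : Ω → 𝕜} (ha : MemLp a p μ)
    (hy : MemLp y p μ) : Integrable (fun ω => parallelogramGain p.toReal (a ω) (y ω)) μ :=
  (((((ha.sub hy).integrable_norm_rpow h0 htop).add
    ((ha.add hy).integrable_norm_rpow h0 htop)).div_const 2).sub
    (ha.integrable_norm_rpow h0 htop)).sub (hy.integrable_norm_rpow h0 htop)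

theorem integrable_parallelogramFluct (h0 : p ≠ 0) (htop : p ≠ ∞) {a y : Ω → 𝕜} (ha : MemLp a p μ)
    (hy : MemLp y p μ) : Integrable (fun ω => parallelogramFluct p.toReal (a ω) (y ω)) μ :=
  ((((ha.sub hy).integrable_norm_rpow h0 htop).sub
    ((ha.add hy).integrable_norm_rpow h0 htop)).div_const 2)

theorem norm_boolSign_mul_sub_rpow (p : ℝ) (b : Bool) (u : ℝ) (y : 𝕜) :
    ‖((boolSign b * u : ℝ) : 𝕜) - y‖ ^ p = (parallelogramGain p (u : 𝕜) y
      + (‖(u : 𝕜)‖ ^ p + ‖y‖ ^ p)) + boolSign b * parallelogramFluct p (u : 𝕜) y := by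
  unfold parallelogramGain parallelogramFluct
  cases b
  · have : ‖((boolSign false * u : ℝ) : 𝕜) - y‖ = ‖(u : 𝕜) + y‖ := by
      rw [← norm_neg]; congr 1; simp [boolSign]; ring
    rw [this]; simp [boolSign]; ring
  · simp [boolSign]; ring

theorem integral_norm_boolSign_mul_sub_rpow (h0 : p ≠ 0) (htop : p ≠ ∞) {n : ℕ} {B : Ω → Fin n}
    (hB : Measurable B) {u : Ω → ℝ} {y : Ω → 𝕜} (hu : MemLp (fun ω => (u ω : 𝕜)) p μ)
    (hy : MemLp y p μ) (hu1 : ∫ ω, ‖(u ω : 𝕜)‖ ^ p.toReal ∂μ = 1)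
    (hy1 : ∫ ω, ‖y ω‖ ^ p.toReal ∂μ = 1) (ε : Fin n → Bool) :
    ∫ ω, ‖((boolSign (ε (B ω)) * u ω : ℝ) : 𝕜) - y ω‖ ^ p.toReal ∂μ
      = (∫ ω, parallelogramGain p.toReal (u ω : 𝕜) (y ω) ∂μ + 2)
        + ∑ j, boolSign (ε j) * ∫ ω in B ⁻¹' {j}, parallelogramFluct p.toReal (u ω : 𝕜) (y ω) ∂μ := by
  have hG := integrable_parallelogramGain h0 htop hu hy
  have hD := integrable_parallelogramFluct h0 htop hu hy
  have iu := hu.integrable_norm_rpow h0 htop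
  have iy := hy.integrable_norm_rpow h0 htop
  have iuy : Integrable (fun ω => ‖(u ω : 𝕜)‖ ^ p.toReal + ‖y ω‖ ^ p.toReal) μ := iu.add iy
  have iGuy : Integrable (fun ω => parallelogramGain p.toReal (u ω : 𝕜) (y ω)
      + (‖(u ω : 𝕜)‖ ^ p.toReal + ‖y ω‖ ^ p.toReal)) μ := hG.add iuy
  simp only [norm_boolSign_mul_sub_rpow]
  rw [integral_add iGuy (integrable_comp_fiber_mul hB (fun j => boolSign (ε j)) hD),
    integral_comp_fiber_mul hB (fun j => boolSign (ε j)) hD, integral_add hG iuy,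
    integral_add iu iy, hu1, hy1]
  norm_num

/-- For `p > 2` there are finitely many unit vectors of `L_p` whose average distance to every unit
vector exceeds `2 ^ (1 / p)`. -/
theorem exists_sign_configuration [SigmaFinite μ] (hp : 2 < p) (htop : p ≠ ∞)
    (hpart : ∀ n : ℕ, 0 < n → ∃ B : Ω → Fin n, Measurable B ∧ ∀ j, μ (B ⁻¹' {j}) ≠ 0) :
    ∃ n : ℕ, ∃ f : (Fin n → Bool) → Ω → 𝕜,
      (∀ ε, MemLp (f ε) p μ ∧ ∫ ω, ‖f ε ω‖ ^ p.toReal ∂μ = 1) ∧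
      ∀ y : Ω → 𝕜, MemLp y p μ → ∫ ω, ‖y ω‖ ^ p.toReal ∂μ = 1 →
        2 ^ n * 2 ^ (1 / p.toReal)
          < ∑ ε, (∫ ω, ‖f ε ω - y ω‖ ^ p.toReal ∂μ) ^ (1 / p.toReal) := by
  have h0 : p ≠ 0 := (lt_trans (by norm_num) hp).ne'
  set P := p.toReal with hPdef
  have hP : 2 < P := by
    have := (ENNReal.toReal_lt_toReal (by norm_num) htop).2 hp
    simpa using this
  set q := 1 / P with hq
  have hq0 : 0 < q := by positivity
  have hq1 : q < 1 := by rw [hq, div_lt_one (by linarith)]; linarith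
  -- Here `c` is slightly above the optimal `q * (1 - q) / 2` and, below, `K` is slightly above `4`,
  -- with `c / 2 * K = q * (1 - q / 2) / (1 - q / 4) < q`. The room left pays for the error terms in
  -- `τ`.
  set c := q / 2 * (1 - q / 2) with hc
  have hc0 : 0 ≤ c := mul_nonneg (by linarith) (by linarith)
  obtain ⟨C, hC, hquart⟩ := exists_quartic_le_one_add_rpow (c := c) hq0 hq1
    (by rw [hc]; nlinarith)
  set K := 4 / (1 - q / 4) with hK
  have hK4 : 4 < K := by rw [hK, lt_div_iff₀ (by linarith)]; linarith
  obtain ⟨K', hK', hsq⟩ := exists_sq_parallelogramFluct_le (𝕜 := 𝕜) hP hK4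
  obtain ⟨C₁, hC₁, hfl₁⟩ := exists_abs_parallelogramFluct_le (E := 𝕜) (p := P) (by linarith) one_pos
  obtain ⟨τ, hτ, hτq⟩ : ∃ τ : ℝ, 0 < τ ∧ (c / 2 + 3 * C / 8 * τ) * (K + τ) < q := by
    have hcont : ContinuousAt (fun τ : ℝ => (c / 2 + 3 * C / 8 * τ) * (K + τ)) 0 := by fun_prop
    have h1 : ∀ᶠ τ in nhds (0 : ℝ), (c / 2 + 3 * C / 8 * τ) * (K + τ) < q := by
      apply hcont.eventually_lt continuousAt_const
      have e : (c / 2 + 3 * C / 8 * 0) * (K + 0) = q * (1 - q / 2) / (1 - q / 4) := by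
        rw [hc, hK]; ring
      rw [e, div_lt_iff₀ (by linarith)]
      nlinarith
    obtain ⟨ε, hε, h⟩ := Metric.eventually_nhds_iff.1 h1
    exact ⟨ε / 2, by positivity, @h (ε / 2) (by simp [abs_of_pos hε, hε])⟩
  set η := τ / (2 * (1 + C₁)) with hη
  have hη0 : 0 < η := by positivity
  obtain ⟨C₂, hC₂, hfl₂⟩ := exists_abs_parallelogramFluct_le (E := 𝕜) (p := P) (by linarith) hη0
  obtain ⟨n, hn⟩ := exists_nat_ge (max 1 (max (K' / τ) (C₂ / η)))
  have hn1 : (1 : ℝ) ≤ n := (le_max_left _ _).trans hn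
  have hnpos : 0 < n := by
    have : (0 : ℝ) < n := by linarith
    exact_mod_cast this
  have hn0 : (0 : ℝ) < n := by linarith
  have hnK : K' / n ≤ τ := by
    rw [div_le_iff₀ hn0, mul_comm, ← div_le_iff₀ hτ]
    exact ((le_max_left _ _).trans (le_max_right _ _)).trans hn
  have hnC : C₂ / n ≤ η := by
    rw [div_le_iff₀ hn0, mul_comm, ← div_le_iff₀ hη0]
    exact ((le_max_right _ _).trans (le_max_right _ _)).trans hn
  obtain ⟨B, hB, hBpos⟩ := hpart n hnpos
  obtain ⟨u, u_meas, u_pos, u_int, hu⟩ :=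
    exists_pos_setIntegral_rpow_eq (p := P) (by linarith) hnpos hB hBpos
  have norm_u : ∀ ω, ‖(u ω : 𝕜)‖ = u ω := fun ω => by
    rw [RCLike.norm_ofReal, abs_of_pos (u_pos ω)]
  have u_memLp : MemLp (fun ω => (u ω : 𝕜)) p μ := by
    refine (integrable_norm_rpow_iff (by fun_prop) h0 htop).1 ?_
    simpa only [norm_u] using u_int
  have u_one : ∫ ω, ‖(u ω : 𝕜)‖ ^ P ∂μ = 1 := by
    simp only [norm_u]
    rw [← sum_setIntegral_fiber hB u_int]
    simp only [hu]
    simp [hn0.ne']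
  have norm_f : ∀ (ε : Fin n → Bool) ω, ‖((boolSign (ε (B ω)) * u ω : ℝ) : 𝕜)‖ = ‖(u ω : 𝕜)‖ := by
    intro ε ω
    cases h : ε (B ω) <;> simp [boolSign]
  refine ⟨n, fun ε ω => ((boolSign (ε (B ω)) * u ω : ℝ) : 𝕜), fun ε => ⟨?_, ?_⟩, ?_⟩
  · refine u_memLp.congr_norm ?_ (.of_forall fun ω => (norm_f ε ω).symm)
    have h1 : Measurable fun ω => boolSign (ε (B ω)) :=
      (measurable_of_finite fun j => boolSign (ε j)).comp hB
    exact (RCLike.measurable_ofReal.comp (h1.mul u_meas)).aestronglyMeasurable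
  · simp only [norm_f]
    exact u_one
  intro y hy hy1
  have key := fun ε => integral_norm_boolSign_mul_sub_rpow h0 htop hB u_memLp hy u_one hy1 ε
  have iG := integrable_parallelogramGain h0 htop u_memLp hy
  have iD := integrable_parallelogramFluct h0 htop u_memLp hy
  have iy := hy.integrable_norm_rpow h0 htop
  have iu := u_memLp.integrable_norm_rpow h0 htop
  rw [← hPdef] at iG iD iy iu
  simp only [← hPdef] at key
  have hG_nonneg : ∀ ω, 0 ≤ parallelogramGain P (u ω : 𝕜) (y ω) :=
    fun ω => parallelogramGain_nonneg hP _ _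
  -- As `u` never vanishes, the gain is positive wherever `y ≠ 0`, a set of positive measure.
  have hGpos : 0 < ∫ ω, parallelogramGain P (u ω : 𝕜) (y ω) ∂μ := by
    rw [integral_pos_iff_support_of_nonneg hG_nonneg iG]
    have h1 : 0 < ∫ ω, ‖y ω‖ ^ P ∂μ := by rw [hy1]; exact one_pos
    rw [integral_pos_iff_support_of_nonneg (fun ω => by positivity) iy] at h1
    refine h1.trans_le (measure_mono fun ω hω => ?_)
    have hyω : y ω ≠ 0 := by
      rintro h
      simp [h, Real.zero_rpow (by linarith : P ≠ 0)] at hω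
    exact (parallelogramGain_pos hP (RCLike.ofReal_ne_zero.2 (u_pos ω).ne') hyω).ne'
  have hYsum : ∑ j, ∫ ω in B ⁻¹' {j}, ‖y ω‖ ^ P ∂μ = 1 := by
    rw [sum_setIntegral_fiber hB iy, hy1]
  have hY0 : ∀ j, 0 ≤ ∫ ω in B ⁻¹' {j}, ‖y ω‖ ^ P ∂μ := fun j =>
    integral_nonneg fun ω => by positivity
  have hY1 : ∀ j, ∫ ω in B ⁻¹' {j}, ‖y ω‖ ^ P ∂μ ≤ 1 := fun j => by
    rw [← hYsum]
    exact Finset.single_le_sum (fun i _ => hY0 i) (Finset.mem_univ j)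
  have hU : ∀ j, ∫ ω in B ⁻¹' {j}, ‖(u ω : 𝕜)‖ ^ P ∂μ = 1 / n := fun j => by
    simp only [norm_u]; exact hu j
  have hD_abs : ∀ η' C' : ℝ, (∀ a b : 𝕜, |parallelogramFluct P a b| ≤ η' * ‖b‖ ^ P + C' * ‖a‖ ^ P) →
      ∀ j, |∫ ω in B ⁻¹' {j}, parallelogramFluct P (u ω : 𝕜) (y ω) ∂μ|
        ≤ η' * (∫ ω in B ⁻¹' {j}, ‖y ω‖ ^ P ∂μ) + C' / n := by
    intro η' C' h j
    calc _ ≤ ∫ ω in B ⁻¹' {j}, |parallelogramFluct P (u ω : 𝕜) (y ω)| ∂μ := abs_integral_le_integral_abs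
      _ ≤ ∫ ω in B ⁻¹' {j}, (η' * ‖y ω‖ ^ P + C' * ‖(u ω : 𝕜)‖ ^ P) ∂μ :=
          integral_mono iD.abs.integrableOn
            ((iy.const_mul _).add (iu.const_mul _)).integrableOn fun ω => h _ _
      _ = _ := by
          rw [integral_add (iy.const_mul _).integrableOn (iu.const_mul _).integrableOn,
            integral_const_mul, integral_const_mul, hU]
          ring
  set D : Fin n → ℝ := fun j => ∫ ω in B ⁻¹' {j}, parallelogramFluct P (u ω : 𝕜) (y ω) ∂μ with hD
  -- A sum of squares is at most the maximum, here `2 * η`, times the `ℓ¹` norm, here at most `1 +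
  -- C₁`; `η` was chosen to make the product `τ`. This controls the quartic term.
  have hVsmall : ∑ j, D j ^ 2 ≤ τ := by
    have a1 : ∀ j, |D j| ≤ 2 * η := fun j => by
      have := hD_abs η C₂ hfl₂ j
      nlinarith [hY1 j]
    have a2 : ∑ j, |D j| ≤ 1 + C₁ := by
      calc ∑ j, |D j| ≤ ∑ j, (1 * (∫ ω in B ⁻¹' {j}, ‖y ω‖ ^ P ∂μ) + C₁ / n) :=
            Finset.sum_le_sum fun j _ => hD_abs 1 C₁ hfl₁ j
        _ = 1 + C₁ := by
            rw [Finset.sum_add_distrib, ← Finset.mul_sum, hYsum]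
            simp; field_simp
    calc ∑ j, D j ^ 2 ≤ ∑ j, 2 * η * |D j| := Finset.sum_le_sum fun j _ => by
            rw [← sq_abs, sq]
            exact mul_le_mul_of_nonneg_right (a1 j) (abs_nonneg _)
      _ = 2 * η * ∑ j, |D j| := by rw [← Finset.mul_sum]
      _ ≤ 2 * η * (1 + C₁) := by gcongr
      _ = τ := by rw [hη]; field_simp
  -- Cauchy–Schwarz on each block: the second factor is at most `K * 1 + K' / n ≤ K + τ`, because
  -- `y` has mass at most `1` on a block and `u` has mass `1 / n`.
  have hVgain : ∑ j, D j ^ 2 ≤ (K + τ) * ∫ ω, parallelogramGain P (u ω : 𝕜) (y ω) ∂μ := by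
    rw [← sum_setIntegral_fiber hB iG, Finset.mul_sum]
    refine Finset.sum_le_sum fun j _ => ?_
    have hG0 : 0 ≤ ∫ ω in B ⁻¹' {j}, parallelogramGain P (u ω : 𝕜) (y ω) ∂μ :=
      integral_nonneg hG_nonneg
    have h1 := sq_integral_le_of_sq_le_mul (μ := μ.restrict (B ⁻¹' {j})) iD.integrableOn
      iG.integrableOn ((iy.const_mul K).add (iu.const_mul K')).integrableOn hG_nonneg
      (fun ω => by simp only [Pi.add_apply]; positivity) (fun ω => hsq (u ω : 𝕜) (y ω))
    have h2 : ∫ ω in B ⁻¹' {j}, ((fun ω => K * ‖y ω‖ ^ P) + fun ω => K' * ‖(u ω : 𝕜)‖ ^ P) ω ∂μ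
        ≤ K + τ := by
      simp only [Pi.add_apply]
      rw [integral_add (iy.const_mul _).integrableOn (iu.const_mul _).integrableOn,
        integral_const_mul, integral_const_mul, hU, mul_one_div]
      nlinarith [hY1 j]
    calc D j ^ 2 ≤ _ := h1
      _ ≤ _ := mul_le_mul_of_nonneg_left h2 hG0
      _ = _ := mul_comm _ _
  have hfinal := two_rpow_lt_mean_sign_rpow (M := ∫ ω, parallelogramGain P (u ω : 𝕜) (y ω) ∂μ + 2)
    hq0 hq1 hc0 hC hquart (by linarith) D
    (fun ε => by
      rw [← key ε]
      exact integral_nonneg fun ω => by positivity)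
    hVsmall
    (by
      rw [add_sub_cancel_right]
      calc _ ≤ (c / 2 + 3 * C / 8 * τ) * ((K + τ) * ∫ ω, parallelogramGain P (u ω : 𝕜) (y ω) ∂μ) := by
            gcongr
        _ = (c / 2 + 3 * C / 8 * τ) * (K + τ) * ∫ ω, parallelogramGain P (u ω : 𝕜) (y ω) ∂μ := by
            ring
        _ < _ := mul_lt_mul_of_pos_right hτq hGpos)
  refine hfinal.trans_le (le_of_eq (Finset.sum_congr rfl fun ε _ => ?_))
  rw [key ε]

/-- There are finitely many unit vectors of `L_p` such that the average of the `p`-th power of the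
distance to any unit vector is at most `2 + η`. -/
theorem exists_disjoint_configuration [SigmaFinite μ] (h0 : p ≠ 0) (htop : p ≠ ∞)
    (hpart : ∀ n : ℕ, 0 < n → ∃ B : Ω → Fin n, Measurable B ∧ ∀ j, μ (B ⁻¹' {j}) ≠ 0)
    {η : ℝ} (hη : 0 < η) :
    ∃ n : ℕ, 0 < n ∧ ∃ f : Fin n → Ω → 𝕜,
      (∀ k, MemLp (f k) p μ ∧ ∫ ω, ‖f k ω‖ ^ p.toReal ∂μ = 1) ∧
      ∀ y : Ω → 𝕜, MemLp y p μ → ∫ ω, ‖y ω‖ ^ p.toReal ∂μ = 1 →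
        ∑ k, ∫ ω, ‖f k ω - y ω‖ ^ p.toReal ∂μ ≤ n * (2 + η) := by
  set P := p.toReal with hPdef
  have hP : 0 < P := ENNReal.toReal_pos h0 htop
  obtain ⟨C, hC, hle⟩ := exists_norm_sub_rpow_le (E := 𝕜) hP (half_pos hη)
  obtain ⟨n, hn⟩ := exists_nat_ge (max 1 (C / (η / 2)))
  have hn1 : (1 : ℝ) ≤ n := (le_max_left _ _).trans hn
  have hn0 : (0 : ℝ) < n := by linarith
  have hnpos : 0 < n := by exact_mod_cast hn0
  have hnC : C ≤ n * (η / 2) := by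
    rw [← div_le_iff₀ (half_pos hη)]
    exact (le_max_right _ _).trans hn
  obtain ⟨B, hB, hBpos⟩ := hpart n hnpos
  obtain ⟨u, u_meas, u_pos, u_int, hu⟩ := exists_pos_setIntegral_rpow_eq (p := P) hP hnpos hB hBpos
  have hBm : ∀ k, MeasurableSet (B ⁻¹' {k}) := fun k => hB (measurableSet_singleton k)
  set f : Fin n → Ω → 𝕜 := fun k =>
    (B ⁻¹' {k}).indicator fun ω => (((n : ℝ) ^ (1 / P) * u ω : ℝ) : 𝕜) with hf
  have norm_f : ∀ k ω, ‖f k ω‖ ^ P = (B ⁻¹' {k}).indicator (fun ω => n * u ω ^ P) ω := by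
    intro k ω
    by_cases hω : ω ∈ B ⁻¹' {k}
    · have h1 : 0 < (n : ℝ) ^ (1 / P) := by positivity
      rw [hf, Set.indicator_of_mem hω]
      simp only [Set.indicator_of_mem hω]
      rw [RCLike.norm_ofReal, abs_of_pos (mul_pos h1 (u_pos ω)),
        Real.mul_rpow h1.le (u_pos ω).le, one_div, Real.rpow_inv_rpow hn0.le hP.ne']
    · rw [hf, Set.indicator_of_notMem hω]
      simp only [Set.indicator_of_notMem hω]
      rw [norm_zero, Real.zero_rpow hP.ne']
  have f_int : ∀ k, Integrable (fun ω => ‖f k ω‖ ^ P) μ := fun k => by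
    simp only [norm_f]
    exact (u_int.const_mul _).indicator (hBm k)
  have f_mem : ∀ k, MemLp (f k) p μ := fun k => by
    refine (integrable_norm_rpow_iff ?_ h0 htop).1 (f_int k)
    exact ((RCLike.measurable_ofReal.comp (u_meas.const_mul _)).indicator
      (hBm k)).aestronglyMeasurable
  have f_one : ∀ k, ∫ ω, ‖f k ω‖ ^ P ∂μ = 1 := fun k => by
    simp only [norm_f]
    rw [integral_indicator (hBm k), integral_const_mul, hu, mul_one_div_cancel hn0.ne']
  refine ⟨n, hnpos, f, fun k => ⟨f_mem k, f_one k⟩, fun y hy hy1 => ?_⟩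
  have iy := hy.integrable_norm_rpow h0 htop
  rw [← hPdef] at iy
  -- Off block `k` the integrand is just `‖y ω‖ ^ P`, so the constant `C` only meets the mass of `y`
  -- on that block. These masses sum to `1`, so the total error from `C` stays bounded as `n` grows.
  have each : ∀ k, ∫ ω, ‖f k ω - y ω‖ ^ P ∂μ
      ≤ (2 + η / 2) + C * ∫ ω in B ⁻¹' {k}, ‖y ω‖ ^ P ∂μ := by
    intro k
    have i1 := (f_int k).const_mul (1 + η / 2)
    have i2 := (iy.indicator (hBm k)).const_mul C
    have i3 : Integrable (fun ω => C * (B ⁻¹' {k}).indicator (fun ω => ‖y ω‖ ^ P) ω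
        + ‖y ω‖ ^ P) μ := i2.add iy
    calc ∫ ω, ‖f k ω - y ω‖ ^ P ∂μ
        ≤ ∫ ω, ((1 + η / 2) * ‖f k ω‖ ^ P
          + (C * (B ⁻¹' {k}).indicator (fun ω => ‖y ω‖ ^ P) ω + ‖y ω‖ ^ P)) ∂μ := by
          refine integral_mono (((f_mem k).sub hy).integrable_norm_rpow h0 htop)
            (i1.add i3) fun ω => ?_
          have hyω : 0 ≤ ‖y ω‖ ^ P := by positivity
          by_cases hω : ω ∈ B ⁻¹' {k}
          · simp only [Set.indicator_of_mem hω]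
            linarith [hle (f k ω) (y ω)]
          · have hfk : f k ω = 0 := by rw [hf]; exact Set.indicator_of_notMem hω _
            simp only [Set.indicator_of_notMem hω, hfk]
            simp [Real.zero_rpow hP.ne']
      _ = _ := by
          rw [integral_add i1 i3, integral_add i2 iy, integral_const_mul,
            integral_const_mul, f_one, hy1, integral_indicator (hBm k)]
          ring
  calc _ ≤ ∑ k, ((2 + η / 2) + C * ∫ ω in B ⁻¹' {k}, ‖y ω‖ ^ P ∂μ) :=
        Finset.sum_le_sum fun k _ => each k
    _ = n * (2 + η / 2) + C := by
        rw [Finset.sum_add_distrib, ← Finset.mul_sum, sum_setIntegral_fiber hB iy, hy1]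
        simp [mul_add]
    _ ≤ _ := by linarith

end Configurations

/-! ### Contradictory bounds on a rendezvous number. -/

theorem IsRendezvousNumber.exists_sum_dist_eq {M : Type*} [MetricSpace M] {r : ℝ}
    (h : IsRendezvousNumber M r) {ι : Type*} [Fintype ι] [Nonempty ι] (x : ι → M) :
    ∃ y : M, ∑ i, dist (x i) y = Fintype.card ι * r := by
  obtain ⟨y, hy⟩ := h (Fintype.card ι) Fintype.card_pos (x ∘ (Fintype.equivFin ι).symm)
  refine ⟨y, ?_⟩
  have hc : (0 : ℝ) < Fintype.card ι := by exact_mod_cast Fintype.card_pos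
  rw [← hy, ← (Fintype.equivFin ι).symm.sum_comp]
  simp only [Function.comp_apply]
  field_simp

/-- A normed group that is isometrically an `L_p` space, `2 < p < ∞`, over a `σ`-finite measure
space which splits into arbitrarily many non-null pieces, has no rendezvous number. -/
theorem not_isRendezvousNumber_of_isometric_Lp {Ω : Type*} [MeasurableSpace Ω] {μ : Measure Ω}
    [SigmaFinite μ] {𝕜 : Type*} [RCLike 𝕜] {p : ℝ≥0∞} (hp : 2 < p) (htop : p ≠ ∞)
    (hpart : ∀ n : ℕ, 0 < n → ∃ B : Ω → Fin n, Measurable B ∧ ∀ j, μ (B ⁻¹' {j}) ≠ 0)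
    {X : Type*} [NormedAddCommGroup X] (T : X → Ω → 𝕜) (hT : ∀ x, MemLp (T x) p μ)
    (hT0 : T 0 =ᵐ[μ] 0) (hsurj : ∀ f : Ω → 𝕜, MemLp f p μ → ∃ x, T x =ᵐ[μ] f)
    (hdist : ∀ x y, dist x y ^ p.toReal = ∫ ω, ‖T x ω - T y ω‖ ^ p.toReal ∂μ) (r : ℝ) :
    ¬ IsRendezvousNumber (Metric.sphere (0 : X) 1) r := by
  intro hr
  have h0 : p ≠ 0 := (lt_trans (by norm_num) hp).ne'
  have hP : 2 < p.toReal := by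
    have := (ENNReal.toReal_lt_toReal (by norm_num) htop).2 hp
    simpa using this
  set P := p.toReal
  have hnorm : ∀ x, ‖x‖ ^ P = ∫ ω, ‖T x ω‖ ^ P ∂μ := fun x => by
    rw [← dist_zero_right, hdist]
    refine integral_congr_ae ?_
    filter_upwards [hT0] with ω hω
    simp [hω]
  -- Transfers the rendezvous property to finite families of unit functions; `y` is the function
  -- representing the point it provides.
  have lift : ∀ {ι : Type} [Fintype ι] [Nonempty ι] (f : ι → Ω → 𝕜),
      (∀ i, MemLp (f i) p μ ∧ ∫ ω, ‖f i ω‖ ^ P ∂μ = 1) →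
      ∃ y : Ω → 𝕜, MemLp y p μ ∧ ∫ ω, ‖y ω‖ ^ P ∂μ = 1 ∧
        ∑ i, (∫ ω, ‖f i ω - y ω‖ ^ P ∂μ) ^ (1 / P) = Fintype.card ι * r := by
    intro ι _ _ f hf
    choose x hx using fun i => hsurj (f i) (hf i).1
    have hx1 : ∀ i, x i ∈ Metric.sphere (0 : X) 1 := fun i => by
      rw [mem_sphere_zero_iff_norm]
      have h1 : ‖x i‖ ^ P = 1 := by
        rw [hnorm, ← (hf i).2]
        refine integral_congr_ae ?_
        filter_upwards [hx i] with ω hω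
        simp [hω]
      rwa [← Real.one_rpow P, Real.rpow_left_inj (norm_nonneg _) zero_le_one (by linarith)] at h1
    obtain ⟨y, hy⟩ := hr.exists_sum_dist_eq fun i => (⟨x i, hx1 i⟩ : Metric.sphere (0 : X) 1)
    refine ⟨T y, hT y, ?_, ?_⟩
    · rw [← hnorm, mem_sphere_zero_iff_norm.1 y.2, Real.one_rpow]
    · rw [← hy]
      refine Finset.sum_congr rfl fun i _ => ?_
      have h2 : ∫ ω, ‖f i ω - T y ω‖ ^ P ∂μ = dist (x i) (y : X) ^ P := by
        rw [hdist]
        refine integral_congr_ae ?_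
        filter_upwards [hx i] with ω hω
        simp [hω]
      rw [h2, one_div, Real.rpow_rpow_inv dist_nonneg (by linarith)]
      rfl
  have hlow : (2 : ℝ) ^ (1 / P) < r := by
    obtain ⟨n, f, hf, hlt⟩ := exists_sign_configuration (𝕜 := 𝕜) hp htop hpart
    obtain ⟨y, hy, hy1, hsum⟩ := lift f hf
    have := hlt y hy hy1
    rw [hsum] at this
    have hcard : ((Fintype.card (Fin n → Bool) : ℕ) : ℝ) = 2 ^ n := by simp
    rw [hcard] at this
    exact lt_of_mul_lt_mul_left this (by positivity)
  have hr0 : 0 < r := lt_trans (by positivity) hlow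
  have hlow' : 2 < r ^ P := by
    have := Real.rpow_lt_rpow (by positivity) hlow (by linarith : 0 < P)
    rwa [one_div, Real.rpow_inv_rpow (by norm_num) (by linarith)] at this
  obtain ⟨n, hn, f, hf, hle⟩ := exists_disjoint_configuration (𝕜 := 𝕜) h0 htop hpart
    (half_pos (sub_pos.2 hlow'))
  have : Nonempty (Fin n) := ⟨⟨0, hn⟩⟩
  obtain ⟨y, hy, hy1, hsum⟩ := lift f hf
  have hup := hle y hy hy1
  have hn0 : (0 : ℝ) < n := by exact_mod_cast hn
  have hI : ∀ k, 0 ≤ ∫ ω, ‖f k ω - y ω‖ ^ P ∂μ := fun k => integral_nonneg fun ω => by positivity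
  -- Convexity of `t ^ P` gives `r ^ P ≤ 2 + (r ^ P - 2) / 2`, impossible when `r ^ P > 2`.
  have hjensen := Real.rpow_arith_mean_le_arith_mean_rpow Finset.univ (fun _ : Fin n => 1 / (n : ℝ))
    (fun k => (∫ ω, ‖f k ω - y ω‖ ^ P ∂μ) ^ (1 / P)) (fun _ _ => by positivity)
    (by simp [hn0.ne']) (fun k _ => Real.rpow_nonneg (hI k) _) (by linarith : 1 ≤ P)
  rw [← Finset.mul_sum, ← Finset.mul_sum, hsum, Fintype.card_fin] at hjensen
  have e1 : ∀ k, ((∫ ω, ‖f k ω - y ω‖ ^ P ∂μ) ^ (1 / P)) ^ P = ∫ ω, ‖f k ω - y ω‖ ^ P ∂μ := fun k => by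
    rw [one_div, Real.rpow_inv_rpow (hI k) (by linarith)]
  simp only [e1] at hjensen
  rw [← mul_assoc, one_div_mul_cancel hn0.ne', one_mul] at hjensen
  have : 1 / (n : ℝ) * ∑ k, ∫ ω, ‖f k ω - y ω‖ ^ P ∂μ ≤ 2 + (r ^ P - 2) / 2 := by
    rw [one_div, inv_mul_eq_div, div_le_iff₀ hn0]
    linarith
  linarith

/-! ### The sequence space and the function space on the unit interval. -/

theorem exists_measurable_partition_nat (n : ℕ) (hn : 0 < n) :
    ∃ B : ℕ → Fin n, Measurable B ∧ ∀ j, (Measure.count : Measure ℕ) (B ⁻¹' {j}) ≠ 0 := by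
  refine ⟨fun k => ⟨k % n, Nat.mod_lt k hn⟩, measurable_from_nat, fun j => ?_⟩
  rw [Ne, Measure.count_eq_zero_iff]
  refine Set.Nonempty.ne_empty ⟨(j : ℕ), ?_⟩
  simp [Nat.mod_eq_of_lt j.2]

theorem exists_measurable_partition_Icc (n : ℕ) (hn : 0 < n) :
    ∃ B : ℝ → Fin n, Measurable B ∧
      ∀ j, (volume.restrict (Set.Icc (0 : ℝ) 1)) (B ⁻¹' {j}) ≠ 0 := by
  have hn0 : (0 : ℝ) < n := by exact_mod_cast hn
  have hm : Measurable fun ω : ℝ => (⟨⌊ω * n⌋₊ % n, Nat.mod_lt _ hn⟩ : Fin n) :=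
    (measurable_from_nat (f := fun k : ℕ => (⟨k % n, Nat.mod_lt k hn⟩ : Fin n))).comp
      (Nat.measurable_floor.comp (measurable_id.mul_const _))
  refine ⟨_, hm, fun j => ?_⟩
  rw [Measure.restrict_apply (hm (measurableSet_singleton j))]
  have hj : (j : ℝ) + 1 ≤ n := by exact_mod_cast j.2
  -- On this interval the floor is `j`; the reduction modulo `n` only forces values into `Fin n` on
  -- the rest of the line.
  have hsub : Set.Ioo ((j : ℝ) / n) ((j + 1) / n) ⊆
      (fun ω : ℝ => (⟨⌊ω * n⌋₊ % n, Nat.mod_lt _ hn⟩ : Fin n)) ⁻¹' {j} ∩ Set.Icc 0 1 := by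
    rintro ω ⟨h1, h2⟩
    have hω : 0 ≤ ω := le_trans (by positivity) h1.le
    refine ⟨?_, hω, h2.le.trans ((div_le_one hn0).2 hj)⟩
    rw [div_lt_iff₀ hn0] at h1
    rw [lt_div_iff₀ hn0] at h2
    have : ⌊ω * n⌋₊ = (j : ℕ) := by
      rw [Nat.floor_eq_iff (by positivity)]
      exact ⟨h1.le, h2⟩
    simp [this, Nat.mod_eq_of_lt j.2]
  refine (lt_of_lt_of_le ?_ (measure_mono hsub)).ne'
  rw [Real.volume_Ioo, ENNReal.ofReal_pos, ← sub_div]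
  simp [hn0]

theorem Lp_dist_rpow_eq_integral {Ω : Type*} [MeasurableSpace Ω] {μ : Measure Ω} {E : Type*}
    [NormedAddCommGroup E] {p : ℝ≥0∞} [Fact (1 ≤ p)] (htop : p ≠ ∞) (x y : Lp E p μ) :
    dist x y ^ p.toReal = ∫ ω, ‖x ω - y ω‖ ^ p.toReal ∂μ := by
  have h0 : p ≠ 0 := (zero_lt_one.trans_le Fact.out).ne'
  rw [_root_.dist_eq_norm, Lp.norm_def, toReal_eLpNorm (Lp.aestronglyMeasurable _),
    lpNorm_eq_integral_norm_rpow_toReal h0 htop (Lp.aestronglyMeasurable _),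
    Real.rpow_inv_rpow (integral_nonneg fun ω => by positivity) (ENNReal.toReal_pos h0 htop).ne']
  refine integral_congr_ae ?_
  filter_upwards [Lp.coeFn_sub x y] with ω hω
  rw [hω, Pi.sub_apply]

theorem memLp_count_of_lp {E : Type*} [NormedAddCommGroup E] {p : ℝ≥0∞} (h0 : p ≠ 0)
    (htop : p ≠ ∞) (x : lp (fun _ : ℕ => E) p) :
    MemLp (fun k => x k) p (Measure.count : Measure ℕ) := by
  refine (integrable_norm_rpow_iff (StronglyMeasurable.of_discrete).aestronglyMeasurable h0 htop).1 ?_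
  rw [integrable_count_iff]
  exact ((lp.memℓp x).summable (ENNReal.toReal_pos h0 htop)).abs

theorem lp_dist_rpow_eq_integral {E : Type*} [NormedAddCommGroup E] {p : ℝ≥0∞} [Fact (1 ≤ p)]
    (htop : p ≠ ∞) (x y : lp (fun _ : ℕ => E) p) :
    dist x y ^ p.toReal = ∫ k, ‖x k - y k‖ ^ p.toReal ∂(Measure.count : Measure ℕ) := by
  have h0 : p ≠ 0 := (zero_lt_one.trans_le Fact.out).ne'
  rw [_root_.dist_eq_norm, lp.norm_rpow_eq_tsum (ENNReal.toReal_pos h0 htop), integral_countable]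
  · simp
  · exact (memLp_count_of_lp h0 htop (x - y)).integrable_norm_rpow h0 htop

theorem theorem1 (𝕜 : Type*) [RCLike 𝕜] (p : ℝ≥0∞) [Fact (1 ≤ p)]
    (hp : 2 < p) (hp_top : p ≠ ∞) :
    ¬ AverageDistanceProperty (lp (fun _ : ℕ => 𝕜) p) ∧
      ¬ AverageDistanceProperty (Lp 𝕜 p (volume.restrict (Set.Icc (0 : ℝ) 1))) := by
  have h0 : p ≠ 0 := (lt_trans (by norm_num) hp).ne'
  constructor
  · rintro ⟨r, hr, -⟩
    refine not_isRendezvousNumber_of_isometric_Lp (μ := Measure.count) hp hp_top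
      exists_measurable_partition_nat (fun (x : lp (fun _ : ℕ => 𝕜) p) k => x k)
      (memLp_count_of_lp h0 hp_top) (.of_forall fun k => by simp) (fun f hf => ?_)
      (lp_dist_rpow_eq_integral hp_top) r hr
    have hs := integrable_count_iff.1 (hf.integrable_norm_rpow h0 hp_top)
    refine ⟨⟨f, memℓp_gen (hs.congr fun k => ?_)⟩, .of_forall fun k => rfl⟩
    rw [Real.norm_of_nonneg (by positivity)]
  · rintro ⟨r, hr, -⟩
    exact not_isRendezvousNumber_of_isometric_Lp hp hp_top exists_measurable_partition_Icc
      (fun (x : Lp 𝕜 p (volume.restrict (Set.Icc (0 : ℝ) 1))) ω => x ω) Lp.memLp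
      (Lp.coeFn_zero _ _ _) (fun f hf => ⟨hf.toLp f, hf.coeFn_toLp⟩)
      (Lp_dist_rpow_eq_integral hp_top) r hr
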